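/- **Conventions.** $\ln$ is the principal logarithm on $\mathbb C\setminus\,]-\infty,0]$, $\arg=\operatorname{Im}\ln$; a negative number may carry either boundary value $\arg=\pi$ or $\arg=-\pi$. Powers are $z^s=e^{s\ln z}$, $\sqrt z=z^{1/2}$. The arguments used are $\arg(1/2k)=-\arg k$, $\arg(2kx)=\arg k$, $\arg(\beta x)=\arg\beta$, $\arg\sqrt{\beta x}=\tfrac12\arg\beta$ for $x>0$, and in (3), (4) $\arg(\beta/2k)=\arg\beta-\arg k$, $\arg(\beta/2\mu)=\arg\beta$. Factors $e^{\pm i\pi/2}z$ in arguments of functions mean analytic continuation by the angle $\pm\pi/2$. Put $(a)_0=1$, $(a)_j=a(a+1)\cdots(a+j-1)$, $1/\Gamma$ is the entire reciprocal Gamma function, and $$\mathcal I_{\beta,m}(z)=z^{\frac12+m}e^{-\frac z2}\sum_{j\ge0}\frac{(\frac12+m-\beta)_j}{\Gamma(1+2m+j)}\frac{z^j}{j!},\qquad \mathcal K_{\beta,m}=\frac{\pi}{\sin 2\pi m}\Big(-\frac{\mathcal I_{\beta,m}}{\Gamma(\frac12-m-\beta)}+\frac{\mathcal I_{\beta,-m}}{\Gamma(\frac12+m-\beta)}\Big),$$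 $$\mathcal J_{\beta,m}(z)=e^{-i\frac\pi2(\frac12+m)}\mathcal I_{-i\beta,m}(e^{i\frac\pi2}z),\qquad \mathcal H^\pm_{\beta,m}(z)=e^{\mp i\frac\pi2(\frac12+m)}\mathcal K_{\pm i\beta,m}(e^{\mp i\frac\pi2}z),$$ and, for the Bessel functions for dimension $1$, $$\mathcal I_m(z)=\sum_{n\ge0}\frac{\sqrt\pi\,(z/2)^{2n+m+\frac12}}{n!\,\Gamma(m+n+1)},\quad \mathcal J_m(z)=\sum_{n\ge0}\frac{(-1)^n\sqrt\pi\,(z/2)^{2n+m+\frac12}}{n!\,\Gamma(m+n+1)},$$ $$\mathcal K_m=\frac{\mathcal I_{-m}-\mathcal I_m}{\sin\pi m},\qquad \mathcal H_m^\pm(z)=e^{\mp i\frac\pi2(m+\frac12)}\mathcal K_m(e^{\mp i\frac\pi2}z),$$ where $\mathcal K_{\beta,m}$ for $m\in\frac12\mathbb Z$ and $\mathcal K_m$ for $m\in\mathbb Z$ are defined by continuity in $m$. **Proposition.** Let $x>0$, $m\in\mathbb C$ with $-1<\operatorname{Re}m<1$, and $\beta\in\mathbb C\setminus\{0\}$.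 Then $$(1)\quad \lim_{k\to0}\Big(\frac1{2k}\Big)^{\frac12+m}\mathcal I_{\frac{\beta}{2k},m}(2kx)=\beta^{-m-\frac12}\frac{(\beta x)^{\frac14}}{\sqrt\pi}\mathcal J_{2m}(2\sqrt{\beta x}),$$ $$(2)\quad \lim_{k\to0}\Big(\frac1{2k}\Big)^{\frac12+m}\mathcal J_{\frac{\beta}{2k},m}(2kx)=\beta^{-m-\frac12}\frac{(\beta x)^{\frac14}}{\sqrt\pi}\mathcal J_{2m}(2\sqrt{\beta x}),$$ where $k\to0$ in $\mathbb C\setminus\{0\}$. For each sign and each $\varepsilon>0$, $$(3)\quad \lim_{k\to0}\ \mp i\,\frac{\Gamma(\frac12+m-\frac\beta{2k})}{\sqrt\pi}\Big(\frac{\beta}{2k}\Big)^{\frac12-m}\mathcal K_{\frac\beta{2k},m}(2kx)=(\beta x)^{\frac14}\mathcal H^\pm_{2m}(2\sqrt{\beta x}),$$ where $k\to0$ with $\pm(\arg\beta-\arg k)\in\,]\varepsilon,\pi-\varepsilon[$. If $\operatorname{Re}\beta>0$, then for each sign $$(4)\quad \lim_{\mu\to0,\ \mu>0}\frac{\Gamma(\frac12+m\mp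 i\frac\beta{2\mu})}{\sqrt\pi}\Big(\frac{\beta}{2\mu}\Big)^{\frac12-m}\mathcal H^\pm_{\frac\beta{2\mu},m}(2\mu x)=(\beta x)^{\frac14}\mathcal H^\pm_{2m}(2\sqrt{\beta x}).$$ -/

import Mathlib

open Filter Topology

/-!
All multivalued functions below are functions of a logarithm `w` of their argument `z = exp w`,
that is, functions on the Riemann surface of the logarithm. Their principal branch at `z` is
the value at `w = Complex.log z`. Multiplying `z` by `e^{± iπ/2}` (analytic continuation by that
angle) is adding `± iπ/2` to `w`; the power `z ^ s` is `exp (s * w)`.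
-/

/-- `ln` is the principal logarithm on `ℂ \ ]-∞,0]`, and on `]-∞,0[` it takes, at each point, one of
the two boundary values `arg = π` or `arg = -π`. -/
def IsPrincipalLn (ln : ℂ → ℂ) : Prop :=
  ∀ z : ℂ, z ≠ 0 → Complex.exp (ln z) = z ∧ |(ln z).im| ≤ Real.pi

/-- Mathlib's logarithm (which has `arg = π` on the negative half-axis) is an admissible choice. -/
theorem isPrincipalLn_log : IsPrincipalLn Complex.log := fun z hz =>
  ⟨Complex.exp_log hz, by rw [Complex.log_im]; exact Complex.abs_arg_le_pi z⟩

/-- Every admissible choice agrees with the principal logarithm off the cut. -/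
theorem IsPrincipalLn.eq_log {ln : ℂ → ℂ} (h : IsPrincipalLn ln) {z : ℂ}
    (hz : z ∈ Complex.slitPlane) : ln z = Complex.log z := by
  obtain ⟨h1, h2⟩ := h z (Complex.slitPlane_ne_zero hz)
  have h3 := abs_le.1 h2
  have hne : (ln z).im ≠ -Real.pi := by
    intro h4
    have hre : z.re = -Real.exp (ln z).re := by
      simpa [Complex.exp_re, h4] using (congrArg Complex.re h1).symm
    have him : z.im = 0 := by
      simpa [Complex.exp_im, h4] using (congrArg Complex.im h1).symm
    rcases Complex.mem_slitPlane_iff.1 hz with h5 | h5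
    · linarith [Real.exp_pos (ln z).re]
    · exact h5 him
  exact (Complex.log_exp (lt_of_le_of_ne h3.1 (Ne.symm hne)) h3.2).symm.trans (by rw [h1])

noncomputable section

/-- The Whittaker function
`I_{β,m}(z) = z^{1/2+m} e^{-z/2} ∑_j (1/2+m-β)_j z^j / (Γ(1+2m+j) j!)` at `z = exp w`.
(`1/Γ` is entire: `Complex.Gamma` is `0` at its poles, and `a / 0 = 0`.) -/
def whittakerI (β m w : ℂ) : ℂ :=
  Complex.exp ((1 / 2 + m) * w) * Complex.exp (-Complex.exp w / 2) *
    ∑' j : ℕ, (ascPochhammer ℂ j).eval (1 / 2 + m - β) / Complex.Gamma (1 + 2 * m + j) *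
      (Complex.exp w ^ j / (j.factorial : ℂ))

/-- The expression defining `K_{β,m}(z)` at `z = exp w` for `m ∉ ½ℤ`. -/
def whittakerKGeneric (β m w : ℂ) : ℂ :=
  Real.pi / Complex.sin (2 * Real.pi * m) *
    (-(whittakerI β m w / Complex.Gamma (1 / 2 - m - β)) +
      whittakerI β (-m) w / Complex.Gamma (1 / 2 + m - β))

open Classical in
/-- The Whittaker function `K_{β,m}(z)` at `z = exp w`, extended by continuity in `m` to
`m ∈ ½ℤ`. -/
def whittakerK (β m w : ℂ) : ℂ :=
  if ∃ n : ℤ, 2 * m = n then limUnder (𝓝[≠] m) (fun m' => whittakerKGeneric β m' w)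
  else whittakerKGeneric β m w

/-- The trigonometric-type Whittaker function
`J_{β,m}(z) = e^{-i(π/2)(1/2+m)} I_{-iβ,m}(e^{iπ/2} z)` at `z = exp w`. -/
def whittakerJ (β m w : ℂ) : ℂ :=
  Complex.exp (-(Complex.I * (Real.pi / 2) * (1 / 2 + m))) *
    whittakerI (-(Complex.I * β)) m (w + Complex.I * (Real.pi / 2))

/-- The trigonometric-type Whittaker functions
`H^±_{β,m}(z) = e^{∓i(π/2)(1/2+m)} K_{±iβ,m}(e^{∓iπ/2} z)` at `z = exp w`; the sign is `σ = ±1`. -/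
def whittakerH (σ : ℝ) (β m w : ℂ) : ℂ :=
  Complex.exp (-(σ * Complex.I * (Real.pi / 2) * (1 / 2 + m))) *
    whittakerK (σ * Complex.I * β) m (w - σ * Complex.I * (Real.pi / 2))

/-- The modified Bessel function for dimension 1,
`I_m(z) = ∑_n √π (z/2)^{2n+m+1/2} / (n! Γ(m+n+1))` at `z = exp w`. -/
def besselI (m w : ℂ) : ℂ :=
  Complex.exp ((m + 1 / 2) * (w - Real.log 2)) *
    ∑' n : ℕ, (√Real.pi : ℂ) * (Complex.exp w / 2) ^ (2 * n) /
      ((n.factorial : ℂ) * Complex.Gamma (m + n + 1))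

/-- The expression defining the Macdonald function for dimension 1 for `m ∉ ℤ`. -/
def besselKGeneric (m w : ℂ) : ℂ :=
  1 / Complex.sin (Real.pi * m) * (-besselI m w + besselI (-m) w)

open Classical in
/-- The Macdonald function for dimension 1, `K_m(z)` at `z = exp w`, extended by continuity in `m`
to `m ∈ ℤ`. -/
def besselK (m w : ℂ) : ℂ :=
  if ∃ n : ℤ, m = n then limUnder (𝓝[≠] m) (fun m' => besselKGeneric m' w)
  else besselKGeneric m w

/-- The Bessel function for dimension 1,
`J_m(z) = ∑_n (-1)^n √π (z/2)^{2n+m+1/2} / (n! Γ(m+n+1))` at `z = exp w`. -/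
def besselJ (m w : ℂ) : ℂ :=
  Complex.exp ((m + 1 / 2) * (w - Real.log 2)) *
    ∑' n : ℕ, (-1) ^ n * (√Real.pi : ℂ) * (Complex.exp w / 2) ^ (2 * n) /
      ((n.factorial : ℂ) * Complex.Gamma (m + n + 1))

/-- The Hankel functions for dimension 1,
`H^±_m(z) = e^{∓i(π/2)(m+1/2)} K_m(e^{∓iπ/2} z)` at `z = exp w`; the sign is `σ = ±1`. -/
def besselH (σ : ℝ) (m w : ℂ) : ℂ :=
  Complex.exp (-(σ * Complex.I * (Real.pi / 2) * (m + 1 / 2))) *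
    besselK m (w - σ * Complex.I * (Real.pi / 2))

end

/-! Put t = 2k. The j-th Pochhammer symbol of I_{β/t,m}, multiplied by t^j, is ∏ (t(1/2+m+i) − β),
so up to a power and an exponential the function I_{β/t,m}(tx) is `whittakerSeries`. This is jointly
continuous in (t, m), also at t = 0, where it is the Bessel series of order 2m. Continuity at t = 0
gives (1), and (2) is the same statement with t = 2ik (`tendsto_whittakerI`).

For K and H^±, write the first index of K as e^L (β/2k in (3), ±iβ/2μ in (4)). Multiplied by
Γ(1/2+m−e^L) e^{(1/2−m)L}, the connection formula becomes π / sin 2πm times `macdonaldNumerator`,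
and Gamma functions survive only in the ratio `gammaFactor`. Since ±Im L stays inside a compact part
of ]0, π[, the point −e^L tends to infinity away from the real axis. There Γ(z+a)/Γ(z+b) ~ z^{a−b},
which makes the ratio tend to e^{∓2πim} (`tendsto_Gamma_ratio`). That is exactly the coefficient in
the corresponding formula for the Hankel function of order 2m (`mul_besselKGeneric_eq`).

When 2m is an integer, sin 2πm vanishes. For |Re m| < 1 this leaves m = 0, ±1/2, where the
numerators vanish too, so both sides are quotients of derivatives in m. All limits are proved
locally uniformly in m, so holomorphy transfers them to the derivatives
(`tendsto_deriv_of_tendsto_prod`). Both cases meet in `tendsto_whittakerK`, from which (3) and (4)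
follow by a choice of L. -/

/-! ### Asymptotics of a ratio of Gamma functions in a sector -/

theorem sum_inv_add_sq_le {r : ℝ} (hr : 1 < r) (n : ℕ) :
    ∑ j ∈ Finset.range n, ((r + j) ^ 2)⁻¹ ≤ (r - 1)⁻¹ := by
  -- Telescoping form of the bound, strong enough for induction.
  have key : ∑ j ∈ Finset.range n, ((r + j) ^ 2)⁻¹ ≤ (r - 1)⁻¹ - (r + n - 1)⁻¹ := by
    induction n with
    | zero => simp
    | succ n ih =>
      rw [Finset.sum_range_succ]
      have hn : (0 : ℝ) ≤ n := n.cast_nonneg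
      have h1 : 0 < r + n - 1 := by linarith
      have h2 : 0 < r + n := by linarith
      have h3 : ((r + n) ^ 2)⁻¹ ≤ (r + n - 1)⁻¹ - (r + n)⁻¹ := by
        rw [inv_sub_inv h1.ne' h2.ne', inv_eq_one_div]
        exact div_le_div₀ (by linarith) (by linarith) (by positivity) (by nlinarith)
      push_cast
      rw [show r + ((n : ℝ) + 1) - 1 = r + n by ring]
      linarith
  have h : 0 ≤ (r + n - 1)⁻¹ := inv_nonneg.2 (by have : (0 : ℝ) ≤ n := n.cast_nonneg; linarith)
  linarith

/-- The points w and w + 1 lie in the same open half-plane, so their arguments differ by less than π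
and no branch jump occurs. -/
theorem log_one_add_inv_of_im_ne_zero {w : ℂ} (hw : w.im ≠ 0) :
    Complex.log (1 + w⁻¹) = Complex.log (w + 1) - Complex.log w := by
  have hw0 : w ≠ 0 := fun h => hw (by simp [h])
  have hw1 : w + 1 ≠ 0 := fun h => hw (by simpa using congrArg Complex.im h)
  have h1 : Complex.exp (Complex.log (w + 1) - Complex.log w) = 1 + w⁻¹ := by
    rw [Complex.exp_sub, Complex.exp_log hw0, Complex.exp_log hw1]
    field_simp
  rw [← h1]
  have him : (w + 1).im = w.im := by simp
  have hb : -Real.pi < (w + 1).arg - w.arg ∧ (w + 1).arg - w.arg ≤ Real.pi := by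
    have p1 := Complex.arg_le_pi w
    have p2 := Complex.arg_le_pi (w + 1)
    have p3 := Complex.neg_pi_lt_arg w
    have p4 := Complex.neg_pi_lt_arg (w + 1)
    rcases lt_or_gt_of_ne hw with h | h
    · have q1 := Complex.arg_neg_iff.2 h
      have q2 := Complex.arg_neg_iff.2 (him.trans_lt h)
      constructor <;> linarith
    · have q1 := Complex.arg_nonneg_iff.2 h.le
      have q2 := Complex.arg_nonneg_iff.2 (h.le.trans_eq him.symm)
      have q3 : w.arg ≠ Real.pi := fun h3 => hw (Complex.arg_eq_pi_iff.1 h3).2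
      constructor
      · have := lt_of_le_of_ne p1 q3
        linarith
      · linarith
  apply Complex.log_exp <;> simp [Complex.log_im, hb]

theorem norm_log_one_add_mul_sub_le {a u : ℂ} {A : ℝ} (ha : ‖a‖ ≤ A) (hu : A * ‖u‖ ≤ 1 / 2) :
    ‖Complex.log (1 + a * u) - a * u‖ ≤ A ^ 2 * ‖u‖ ^ 2 := by
  have h0 : ‖a * u‖ ≤ A * ‖u‖ := by rw [norm_mul]; gcongr
  have h1 : ‖a * u‖ ≤ 1 / 2 := h0.trans hu
  have h2 : (1 - ‖a * u‖)⁻¹ ≤ 2 := by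
    rw [inv_le_comm₀ (by linarith) two_pos]; linarith
  calc _ ≤ ‖a * u‖ ^ 2 * (1 - ‖a * u‖)⁻¹ / 2 :=
        Complex.norm_log_one_add_sub_self_le (by linarith)
    _ ≤ ‖a * u‖ ^ 2 * 2 / 2 := by gcongr
    _ = ‖a * u‖ ^ 2 := by ring
    _ ≤ (A * ‖u‖) ^ 2 := by gcongr
    _ = _ := by ring

/-- The logarithm of one factor in the product for `Γ (z + a) / Γ (z + b) * z ^ (b - a)`, where
`u = (z + j)⁻¹`. -/
noncomputable def gammaRatioLog (a b u : ℂ) : ℂ :=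
  Complex.log (1 + b * u) - Complex.log (1 + a * u) + (a - b) * Complex.log (1 + u)

/-- The linear terms bu − au + (a − b)u cancel, leaving three quadratic remainders bounded by A², A²
and 2A ≤ 2A² times ‖u‖². -/
theorem norm_gammaRatioLog_le {a b u : ℂ} {A : ℝ} (hA : 1 ≤ A) (ha : ‖a‖ ≤ A) (hb : ‖b‖ ≤ A)
    (hu : A * ‖u‖ ≤ 1 / 2) : ‖gammaRatioLog a b u‖ ≤ 4 * A ^ 2 * ‖u‖ ^ 2 := by
  have h1 := norm_log_one_add_mul_sub_le ha hu
  have h2 := norm_log_one_add_mul_sub_le hb hu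
  have h3 := norm_log_one_add_mul_sub_le (a := 1) (u := u) (A := 1) (by simp)
    (by nlinarith [norm_nonneg u])
  rw [one_mul, one_pow, one_mul] at h3
  have hab : ‖a - b‖ ≤ 2 * A := (norm_sub_le a b).trans (by linarith)
  have h4 : ‖(a - b) * (Complex.log (1 + u) - u)‖ ≤ 2 * A ^ 2 * ‖u‖ ^ 2 := by
    rw [norm_mul]
    calc _ ≤ (2 * A) * ‖u‖ ^ 2 := by gcongr
      _ ≤ _ := by
        have : A ≤ A ^ 2 := by nlinarith
        nlinarith [sq_nonneg ‖u‖]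
  have e : gammaRatioLog a b u = (Complex.log (1 + b * u) - b * u)
      - (Complex.log (1 + a * u) - a * u) + (a - b) * (Complex.log (1 + u) - u) := by
    unfold gammaRatioLog; ring
  rw [e]
  refine (norm_add_le _ _).trans ?_
  have := norm_sub_le (Complex.log (1 + b * u) - b * u) (Complex.log (1 + a * u) - a * u)
  linarith

/-- The terms (a − b) log(1 + 1/(z+j)) telescope, and the denominators z + j cancel between the two
products. -/
theorem exp_sum_gammaRatioLog {z a b : ℂ} (hz : z.im ≠ 0) (ha : ∀ j : ℕ, z + a + j ≠ 0)
    (hb : ∀ j : ℕ, z + b + j ≠ 0) (n : ℕ) :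
    Complex.exp (∑ j ∈ Finset.range n, gammaRatioLog a b (z + j)⁻¹) =
      (∏ j ∈ Finset.range n, (z + b + j)) / (∏ j ∈ Finset.range n, (z + a + j)) *
        Complex.exp ((a - b) * (Complex.log (z + n) - Complex.log z)) := by
  induction n with
  | zero => simp
  | succ n ih =>
    have hzn : (z + n).im ≠ 0 := by simpa using hz
    have hzn0 : z + n ≠ 0 := fun h => hzn (by simp [h])
    have key : ∀ c : ℂ, z + c + n ≠ 0 →
        Complex.exp (Complex.log (1 + c * (z + n)⁻¹)) = (z + c + n) / (z + n) := by
      intro c hc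
      have e : 1 + c * (z + n)⁻¹ = (z + c + n) / (z + n) := by field_simp; ring
      rw [e, Complex.exp_log (div_ne_zero hc hzn0)]
    rw [Finset.sum_range_succ, Complex.exp_add, ih, Finset.prod_range_succ,
      Finset.prod_range_succ, gammaRatioLog, log_one_add_inv_of_im_ne_zero hzn, Complex.exp_add,
      Complex.exp_sub, key a (ha n), key b (hb n)]
    have e2 : Complex.exp ((a - b) * (Complex.log (z + ↑(n + 1)) - Complex.log z)) =
        Complex.exp ((a - b) * (Complex.log (z + n) - Complex.log z)) *
        Complex.exp ((a - b) * (Complex.log (z + n + 1) - Complex.log (z + n))) := by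
      rw [← Complex.exp_add, Nat.cast_succ, ← add_assoc]
      congr 1
      ring
    rw [e2]
    have hp : ∏ j ∈ Finset.range n, (z + a + j) ≠ 0 := Finset.prod_ne_zero_iff.2 fun j _ => ha j
    have := ha n
    field_simp

theorem tendsto_log_natCast_sub_log_add (z : ℂ) :
    Tendsto (fun n : ℕ => Complex.log n - Complex.log (z + ↑(n + 1))) atTop (𝓝 0) := by
  have h1 : Tendsto (fun n : ℕ => ((z + 1) / n + 1 : ℂ)) atTop (𝓝 1) := by
    have := (tendsto_const_div_atTop_nhds_zero_nat (𝕜 := ℂ) (z + 1)).add_const 1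
    simpa using this
  have h2 := (h1.clog (by simp)).neg
  rw [Complex.log_one, neg_zero] at h2
  have hne : ∀ᶠ n : ℕ in atTop, (z + 1) / n + 1 ≠ (0 : ℂ) := h1.eventually_ne one_ne_zero
  refine h2.congr' ?_
  filter_upwards [eventually_gt_atTop 0, hne] with n hn hne
  have hn' : (n : ℂ) ≠ 0 := by exact_mod_cast hn.ne'
  have e : z + ↑(n + 1) = ((n : ℝ) : ℂ) * ((z + 1) / n + 1) := by
    push_cast; field_simp; ring
  rw [e, Complex.log_ofReal_mul (by exact_mod_cast hn) hne, Complex.ofReal_log (by positivity)]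
  push_cast
  ring

/-- By Euler's limit formula the normalised ratio is the limit of exp of partial sums of
`gammaRatioLog`. These sums are bounded uniformly in n by a quantity of order 1/‖z‖, which survives
the limit. -/
theorem norm_Gamma_ratio_sub_one_le {A c : ℝ} (hA : 1 ≤ A) (hc : 0 < c) {z a b : ℂ}
    (ha : ‖a‖ ≤ A) (hb : ‖b‖ ≤ A) (hz : z.im ≠ 0) (hsec : ∀ j : ℕ, c * (‖z‖ + j) ≤ ‖z + j‖)
    (hzA : 2 * A ≤ c * ‖z‖) (hz1 : 1 < ‖z‖) (hD : 4 * A ^ 2 / c ^ 2 * (‖z‖ - 1)⁻¹ ≤ 1) :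
    ‖Complex.Gamma (z + a) / Complex.Gamma (z + b) * Complex.exp ((b - a) * Complex.log z) - 1‖ ≤
      2 * (4 * A ^ 2 / c ^ 2 * (‖z‖ - 1)⁻¹) := by
  have hbig : ∀ j : ℕ, 2 * A ≤ ‖z + j‖ := fun j => by
    have : (0 : ℝ) ≤ j := j.cast_nonneg
    nlinarith [hsec j]
  have hne : ∀ d : ℂ, ‖d‖ ≤ A → ∀ j : ℕ, z + d + j ≠ 0 := by
    intro d hd j h0
    have e : z + j = -d := by linear_combination h0
    have := hbig j
    rw [e, norm_neg] at this
    linarith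
  have hGne : Complex.Gamma (z + b) ≠ 0 :=
    Complex.Gamma_ne_zero fun j h => hne b hb j (by rw [h]; ring)
  set E : ℕ → ℂ := fun n => ∑ j ∈ Finset.range n, gammaRatioLog a b (z + j)⁻¹ with hE
  have hEle : ∀ n, ‖E n‖ ≤ 4 * A ^ 2 / c ^ 2 * (‖z‖ - 1)⁻¹ := by
    intro n
    refine (norm_sum_le _ _).trans ?_
    calc _ ≤ ∑ j ∈ Finset.range n, 4 * A ^ 2 / c ^ 2 * ((‖z‖ + j) ^ 2)⁻¹ := by
          refine Finset.sum_le_sum fun j _ => ?_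
          have hj : 0 < ‖z‖ + j := by positivity
          have hp : 0 < ‖z + j‖ := by linarith [hbig j]
          refine (norm_gammaRatioLog_le hA ha hb ?_).trans ?_
          · rw [norm_inv, ← div_eq_mul_inv, div_le_iff₀ hp]
            linarith [hbig j]
          · rw [norm_inv]
            calc 4 * A ^ 2 * ‖z + j‖⁻¹ ^ 2 ≤ 4 * A ^ 2 * (c * (‖z‖ + j))⁻¹ ^ 2 := by
                  gcongr; exact hsec j
              _ = _ := by field_simp
      _ = 4 * A ^ 2 / c ^ 2 * ∑ j ∈ Finset.range n, ((‖z‖ + j) ^ 2)⁻¹ := by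
          rw [Finset.mul_sum]
      _ ≤ _ := by gcongr; exact sum_inv_add_sq_le hz1 n
  have hlim : Tendsto (fun n : ℕ => Complex.GammaSeq (z + a) n / Complex.GammaSeq (z + b) n *
      Complex.exp ((b - a) * Complex.log z) *
      Complex.exp (-((a - b) * (Complex.log n - Complex.log (z + ↑(n + 1)))))) atTop
      (𝓝 (Complex.Gamma (z + a) / Complex.Gamma (z + b) *
        Complex.exp ((b - a) * Complex.log z))) := by
    have h1 := ((Complex.GammaSeq_tendsto_Gamma (z + a)).div
      (Complex.GammaSeq_tendsto_Gamma (z + b)) hGne).mul_const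
        (Complex.exp ((b - a) * Complex.log z))
    have h2 := ((tendsto_log_natCast_sub_log_add z).const_mul (a - b)).neg.cexp
    simpa using h1.mul h2
  have heq : ∀ᶠ n : ℕ in atTop, Complex.GammaSeq (z + a) n / Complex.GammaSeq (z + b) n *
      Complex.exp ((b - a) * Complex.log z) *
      Complex.exp (-((a - b) * (Complex.log n - Complex.log (z + ↑(n + 1))))) =
      Complex.exp (E (n + 1)) := by
    filter_upwards [eventually_gt_atTop 0] with n hn
    have hn' : (n : ℂ) ≠ 0 := by exact_mod_cast hn.ne'
    rw [hE, exp_sum_gammaRatioLog hz (hne a ha) (hne b hb), Complex.GammaSeq, Complex.GammaSeq,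
      Complex.cpow_def_of_ne_zero hn', Complex.cpow_def_of_ne_zero hn']
    have hpa : ∏ j ∈ Finset.range (n + 1), (z + a + j) ≠ 0 :=
      Finset.prod_ne_zero_iff.2 fun j _ => hne a ha j
    have hpb : ∏ j ∈ Finset.range (n + 1), (z + b + j) ≠ 0 :=
      Finset.prod_ne_zero_iff.2 fun j _ => hne b hb j
    have hf : (n.factorial : ℂ) ≠ 0 := by exact_mod_cast n.factorial_ne_zero
    have e : Complex.exp ((a - b) * (Complex.log (z + ↑(n + 1)) - Complex.log z)) *
        Complex.exp (Complex.log n * (z + b)) = Complex.exp (Complex.log n * (z + a)) *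
          Complex.exp ((b - a) * Complex.log z) *
          Complex.exp (-((a - b) * (Complex.log n - Complex.log (z + ↑(n + 1))))) := by
      simp only [← Complex.exp_add]
      congr 1
      ring
    have he := Complex.exp_ne_zero (Complex.log n * (z + b))
    field_simp
    linear_combination -e
  refine le_of_tendsto ((hlim.congr' heq).sub_const 1).norm (Eventually.of_forall fun n => ?_)
  exact (Complex.norm_exp_sub_one_le ((hEle _).trans hD)).trans
    (mul_le_mul_of_nonneg_left (hEle _) two_pos.le)

/-- For j ≤ 2‖z‖ the imaginary part alone suffices; for larger j the triangle inequality gives j −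
‖z‖ ≥ (‖z‖ + j)/3. -/
theorem sector_mul_add_le_norm_add {c : ℝ} (hc0 : 0 ≤ c) (hc : c ≤ 1) {z : ℂ}
    (hz : c * ‖z‖ ≤ |z.im|) (j : ℕ) : c / 3 * (‖z‖ + j) ≤ ‖z + j‖ := by
  have hj : (0 : ℝ) ≤ j := j.cast_nonneg
  have hn := norm_nonneg z
  rcases le_total (j : ℝ) (2 * ‖z‖) with h | h
  · have h1 : |z.im| ≤ ‖z + j‖ := by simpa using Complex.abs_im_le_norm (z + j)
    nlinarith
  · have h1 : (j : ℝ) - ‖z‖ ≤ ‖z + j‖ := by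
      have := norm_sub_norm_le (j : ℂ) (-z)
      rw [norm_neg, sub_neg_eq_add, Complex.norm_natCast, add_comm (j : ℂ)] at this
      exact this
    nlinarith

theorem sign_sin_le_abs_sin {σ : ℝ} (hσ : σ = 1 ∨ σ = -1) {ε y : ℝ} (hε : 0 < ε)
    (hy : σ * y ∈ Set.Ioo ε (Real.pi - ε)) : Real.sin ε ≤ |Real.sin y| := by
  have h1 : |Real.sin y| = |Real.sin (σ * y)| := by
    rcases hσ with rfl | rfl <;> simp
  rw [h1]
  refine le_trans ?_ (le_abs_self _)
  obtain ⟨h2, h3⟩ := hy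
  rcases le_total (σ * y) (Real.pi / 2) with h | h
  · exact Real.sin_le_sin_of_le_of_le_pi_div_two (by linarith [Real.pi_pos]) h h2.le
  · rw [← Real.sin_pi_sub (σ * y)]
    exact Real.sin_le_sin_of_le_of_le_pi_div_two (by linarith [Real.pi_pos]) (by linarith)
      (by linarith)

/-- The previous estimate applies at z = −e^L, whose principal logarithm is L − σiπ; this shift
produces the phase in the limit. Letting m vary in the product filter makes the convergence locally
uniform in m. -/
theorem tendsto_Gamma_ratio {ι : Type*} {l : Filter ι} {σ : ℝ} (hσ : σ = 1 ∨ σ = -1) {ε : ℝ}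
    (hε : 0 < ε) {L : ι → ℂ} (hL : ∀ᶠ i in l, σ * (L i).im ∈ Set.Ioo ε (Real.pi - ε))
    (hre : Tendsto (fun i => (L i).re) l atTop) (m₀ : ℂ) :
    Tendsto (fun p : ι × ℂ => Complex.Gamma (1 / 2 + p.2 - Complex.exp (L p.1)) /
        Complex.Gamma (1 / 2 - p.2 - Complex.exp (L p.1)) * Complex.exp (-2 * p.2 * L p.1))
      (l ×ˢ 𝓝 m₀) (𝓝 (Complex.exp (-(σ * Complex.I * (2 * Real.pi * m₀))))) := by
  rcases l.eq_or_neBot with rfl | _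
  · simp
  have hε2 : ε < Real.pi / 2 := by
    obtain ⟨i, hi⟩ := hL.exists
    linarith [hi.1.trans hi.2]
  have hs : 0 < Real.sin ε := Real.sin_pos_of_pos_of_lt_pi hε (by linarith [Real.pi_pos])
  set c : ℝ := Real.sin ε / 3 with hc
  have hc0 : 0 < c := by positivity
  -- Bounds both 1/2 + m and 1/2 − m when ‖m − m₀‖ < 1.
  set A : ℝ := ‖m₀‖ + 2 with hAdef
  have hA1 : 1 ≤ A := by linarith [norm_nonneg m₀]
  have hnorm : Tendsto (fun p : ι × ℂ => Real.exp (L p.1).re) (l ×ˢ 𝓝 m₀) atTop :=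
    (Real.tendsto_exp_atTop.comp hre).comp tendsto_fst
  have hbd : Tendsto (fun p : ι × ℂ => 4 * A ^ 2 / c ^ 2 * (Real.exp (L p.1).re - 1)⁻¹)
      (l ×ˢ 𝓝 m₀) (𝓝 0) := by
    have := (tendsto_inv_atTop_zero.comp (tendsto_atTop_add_const_right _ (-1) hnorm)).const_mul
      (4 * A ^ 2 / c ^ 2)
    simpa [Function.comp_def, sub_eq_add_neg] using this
  have hmain : Tendsto (fun p : ι × ℂ => Complex.Gamma (1 / 2 + p.2 - Complex.exp (L p.1)) /
        Complex.Gamma (1 / 2 - p.2 - Complex.exp (L p.1)) *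
        Complex.exp (-2 * p.2 * (L p.1 - σ * Complex.I * Real.pi))) (l ×ˢ 𝓝 m₀) (𝓝 1) := by
    rw [tendsto_iff_norm_sub_tendsto_zero]
    refine squeeze_zero' (Eventually.of_forall fun _ => norm_nonneg _) ?_
      (by simpa using hbd.const_mul 2)
    have hm : ∀ᶠ p : ι × ℂ in l ×ˢ 𝓝 m₀, ‖p.2 - m₀‖ < 1 := by
      have := (Metric.ball_mem_nhds m₀ one_pos)
      filter_upwards [tendsto_snd.eventually this] with p hp
      simpa [dist_eq_norm] using hp
    filter_upwards [hm, tendsto_fst.eventually hL, hnorm.eventually_ge_atTop (2 * A / c),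
      hnorm.eventually_gt_atTop 1, hbd.eventually_le_const one_pos] with p hm hL h2A h1 hD
    set z : ℂ := -Complex.exp (L p.1) with hz
    have hzn : ‖z‖ = Real.exp (L p.1).re := by rw [hz, norm_neg, Complex.norm_exp]
    have hzim : |z.im| = ‖z‖ * |Real.sin (L p.1).im| := by
      rw [hzn, hz, Complex.neg_im, Complex.exp_im, abs_neg, abs_mul, Real.abs_exp]
    have hsin := sign_sin_le_abs_sin hσ hε hL
    have hzim' : Real.sin ε * ‖z‖ ≤ |z.im| := by
      rw [hzim, mul_comm]; gcongr
    have hzlog : Complex.log z = L p.1 - σ * Complex.I * Real.pi := by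
      have e : z = Complex.exp (L p.1 - σ * Complex.I * Real.pi) := by
        have e1 : Complex.exp (σ * Complex.I * Real.pi) = -1 := by
          rcases hσ with rfl | rfl
          · simp [mul_comm Complex.I, Complex.exp_pi_mul_I]
          · simp [mul_comm Complex.I, Complex.exp_neg, Complex.exp_pi_mul_I]
        rw [Complex.exp_sub, e1, hz, div_neg, div_one]
      have him : (L p.1 - σ * Complex.I * Real.pi).im = (L p.1).im - σ * Real.pi := by simp
      rw [e]
      have := hL.1
      have := hL.2
      apply Complex.log_exp <;> rw [him] <;> rcases hσ with rfl | rfl <;> linarith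
    have hhalf : ‖(1 / 2 : ℂ)‖ = 1 / 2 := by simp
    have hp2 : ‖p.2‖ ≤ ‖m₀‖ + 1 := by
      have := norm_sub_norm_le p.2 m₀
      linarith
    have hb := norm_Gamma_ratio_sub_one_le (z := z) (a := 1 / 2 + p.2) (b := 1 / 2 - p.2) hA1 hc0
      ((norm_add_le _ _).trans (by rw [hhalf]; linarith))
      ((norm_sub_le _ _).trans (by rw [hhalf]; linarith))
      (by
        have h0 : 0 < |z.im| := lt_of_lt_of_le (by rw [hzn]; positivity) hzim'
        exact abs_pos.1 h0)
      (sector_mul_add_le_norm_add hs.le (Real.sin_le_one ε) hzim')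
      (by rw [div_le_iff₀ hc0] at h2A; rw [hzn]; linarith) (by rw [hzn]; exact h1)
      (by rw [hzn]; exact hD)
    rw [hzlog, hzn] at hb
    rwa [show 1 / 2 + p.2 - Complex.exp (L p.1) = z + (1 / 2 + p.2) by rw [hz]; ring,
      show 1 / 2 - p.2 - Complex.exp (L p.1) = z + (1 / 2 - p.2) by rw [hz]; ring,
      show -2 * p.2 = 1 / 2 - p.2 - (1 / 2 + p.2) by ring]
  have h2 : Tendsto (fun p : ι × ℂ => Complex.exp (-(σ * Complex.I * (2 * Real.pi * p.2))))
      (l ×ˢ 𝓝 m₀) (𝓝 (Complex.exp (-(σ * Complex.I * (2 * Real.pi * m₀))))) := by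
    have : Continuous fun m : ℂ => Complex.exp (-(σ * Complex.I * (2 * Real.pi * m))) := by
      fun_prop
    exact (this.tendsto m₀).comp tendsto_snd
  have h3 := hmain.mul h2
  rw [one_mul] at h3
  refine h3.congr fun p => ?_
  rw [mul_assoc, ← Complex.exp_add]
  congr 2
  ring

/-! ### The common power series of the Whittaker and Bessel functions -/

/-- Compactness handles finitely many j. Beyond 2R + 1 one has ‖s + j‖ ≥ (j+1)/2, so each step of
the functional equation gains a factor 2/(j+1). -/
theorem exists_norm_inv_Gamma_add_le (R : ℝ) :
    ∃ C : ℝ, 0 ≤ C ∧ ∀ s : ℂ, ‖s‖ ≤ R → ∀ j : ℕ,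
      ‖(Complex.Gamma (s + j))⁻¹‖ ≤ C * (2 ^ j / j.factorial) := by
  have hfin : ∀ N : ℕ, ∃ C : ℝ, 0 ≤ C ∧ ∀ s : ℂ, ‖s‖ ≤ R → ∀ j ≤ N,
      ‖(Complex.Gamma (s + j))⁻¹‖ ≤ C * (2 ^ j / j.factorial) := by
    have hone : ∀ j : ℕ, ∃ C : ℝ, 0 ≤ C ∧ ∀ s : ℂ, ‖s‖ ≤ R →
        ‖(Complex.Gamma (s + j))⁻¹‖ ≤ C * (2 ^ j / j.factorial) := by
      intro j
      have hcont : Continuous fun s : ℂ => (Complex.Gamma (s + j))⁻¹ :=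
        Complex.differentiable_one_div_Gamma.continuous.comp (continuous_id.add continuous_const)
      obtain ⟨C, hC⟩ := (isCompact_closedBall (0 : ℂ) R).exists_bound_of_continuousOn
        hcont.continuousOn
      refine ⟨max C 0 / (2 ^ j / j.factorial), by positivity, fun s hs => ?_⟩
      rw [div_mul_cancel₀ _ (by positivity)]
      exact (hC s (by simpa using hs)).trans (le_max_left _ _)
    intro N
    induction N with
    | zero =>
      obtain ⟨C, h0, hC⟩ := hone 0
      exact ⟨C, h0, fun s hs j hj => by obtain rfl := Nat.le_zero.1 hj; exact hC s hs⟩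
    | succ N ih =>
      obtain ⟨C, h0, hC⟩ := ih
      obtain ⟨C', h0', hC'⟩ := hone (N + 1)
      refine ⟨C + C', by positivity, fun s hs j hj => ?_⟩
      rcases Nat.le_succ_iff.1 hj with h | rfl
      · exact (hC s hs j h).trans (by gcongr; linarith)
      · exact (hC' s hs).trans (by gcongr; linarith)
  obtain ⟨N, hN⟩ := exists_nat_ge (2 * R + 1)
  obtain ⟨C, h0, hC⟩ := hfin N
  refine ⟨C, h0, fun s hs j => ?_⟩
  rcases le_total j N with h | h
  · exact hC s hs j h
  induction j, h using Nat.le_induction with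
  | base => exact hC s hs N le_rfl
  | succ j hj ih =>
    have hjN : (N : ℝ) ≤ j := by exact_mod_cast hj
    have h1 : ((j : ℝ) + 1) / 2 ≤ ‖s + j‖ := by
      have := norm_sub_norm_le (j : ℂ) (-s)
      rw [norm_neg, sub_neg_eq_add, Complex.norm_natCast, add_comm (j : ℂ)] at this
      linarith
    have hpos : (0 : ℝ) < ((j : ℝ) + 1) / 2 := by positivity
    have hne : s + j ≠ 0 := norm_pos_iff.1 (hpos.trans_le h1)
    rw [Nat.cast_succ, ← add_assoc, Complex.Gamma_add_one _ hne, mul_inv, norm_mul, norm_inv]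
    calc ‖s + j‖⁻¹ * ‖(Complex.Gamma (s + j))⁻¹‖
        ≤ (((j : ℝ) + 1) / 2)⁻¹ * (C * (2 ^ j / j.factorial)) := by gcongr
      _ = C * (2 ^ (j + 1) / (j + 1).factorial) := by
        rw [Nat.factorial_succ, pow_succ]; push_cast; field_simp

/-- The terms of `whittakerSeries`. -/
noncomputable def whittakerTerm (β x t m : ℂ) (j : ℕ) : ℂ :=
  (∏ i ∈ Finset.range j, (t * (1 / 2 + m + i) - β)) * (Complex.Gamma (1 + 2 * m + j))⁻¹ *
    (x ^ j / j.factorial)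

/-- The power series of the Whittaker function `I_{β/t,m}` at `t x`, extended to `t = 0`. -/
noncomputable def whittakerSeries (β x t m : ℂ) : ℂ := ∑' j : ℕ, whittakerTerm β x t m j

/-- The product grows at most like D^j j!, and the reciprocal Gamma function cancels the factorial,
so an exponential series majorises uniformly for bounded (t, m), t = 0 included. -/
theorem exists_summable_bound_whittakerTerm (β x : ℂ) (R : ℝ) :
    ∃ u : ℕ → ℝ, Summable u ∧ ∀ t m : ℂ, ‖t‖ ≤ R → ‖m‖ ≤ R →
      ∀ j, ‖whittakerTerm β x t m j‖ ≤ u j := by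
  rcases lt_or_ge R 0 with hR | hR
  · exact ⟨0, summable_zero, fun t m ht => absurd (norm_nonneg t) (by linarith)⟩
  obtain ⟨C, hC0, hC⟩ := exists_norm_inv_Gamma_add_le (1 + 2 * R)
  set D : ℝ := R * (1 + R) + ‖β‖ with hD
  have hD0 : 0 ≤ D := by positivity
  refine ⟨fun j => C * ((2 * D * ‖x‖) ^ j / j.factorial),
    (Real.summable_pow_div_factorial _).mul_left C, fun t m ht hm j => ?_⟩
  have hprod : ‖∏ i ∈ Finset.range j, (t * (1 / 2 + m + i) - β)‖ ≤ D ^ j * j.factorial := by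
    induction j with
    | zero => simp
    | succ j ih =>
      rw [Finset.prod_range_succ, norm_mul, pow_succ, Nat.factorial_succ]
      have h1 : ‖t * (1 / 2 + m + j) - β‖ ≤ D * (j + 1) := by
        have hh : ‖(1 / 2 : ℂ)‖ = 1 / 2 := by simp
        have h2 : ‖(1 / 2 + m + j : ℂ)‖ ≤ 1 / 2 + R + j := by
          refine (norm_add₃_le).trans ?_
          rw [hh, Complex.norm_natCast]
          gcongr
        have hj : (0 : ℝ) ≤ j := j.cast_nonneg
        calc _ ≤ ‖t‖ * ‖(1 / 2 + m + j : ℂ)‖ + ‖β‖ := by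
              rw [← norm_mul]; exact norm_sub_le _ _
          _ ≤ R * (1 / 2 + R + j) + ‖β‖ := by gcongr
          _ ≤ R * ((1 + R) * (j + 1)) + ‖β‖ * (j + 1) := by
              gcongr
              · nlinarith
              · nlinarith [norm_nonneg β]
          _ = _ := by rw [hD]; ring
      calc _ ≤ (D ^ j * j.factorial) * (D * (j + 1)) := by gcongr
        _ = _ := by push_cast; ring
  have hG := hC (1 + 2 * m) ((norm_add_le _ _).trans (by
    rw [norm_one, norm_mul, RCLike.norm_ofNat]; linarith)) j
  rw [whittakerTerm, norm_mul, norm_mul, norm_div, norm_pow, Complex.norm_natCast]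
  calc _ ≤ (D ^ j * j.factorial) * (C * (2 ^ j / j.factorial)) * (‖x‖ ^ j / j.factorial) := by
        gcongr
    _ = _ := by simp only [mul_pow]; field_simp

theorem differentiable_inv_Gamma_affine (j : ℕ) :
    Differentiable ℂ fun m : ℂ => (Complex.Gamma (1 + 2 * m + j))⁻¹ :=
  Complex.differentiable_one_div_Gamma.comp (by fun_prop)

theorem differentiable_whittakerSeries (β x t : ℂ) :
    Differentiable ℂ fun m => whittakerSeries β x t m := by
  intro m
  obtain ⟨u, hu, hb⟩ := exists_summable_bound_whittakerTerm β x (max ‖t‖ (‖m‖ + 1))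
  have := Complex.differentiableOn_tsum_of_summable_norm (F := fun j m => whittakerTerm β x t m j)
    hu (fun j => Differentiable.differentiableOn ?_) (Metric.isOpen_ball (x := m) (ε := 1))
    (fun j w hw => hb t w (le_max_left _ _) (le_trans ?_ (le_max_right _ _)) j)
  · exact this.differentiableAt (Metric.ball_mem_nhds m one_pos)
  · refine Differentiable.mul (Differentiable.mul ?_ (differentiable_inv_Gamma_affine j)) ?_
    · fun_prop
    · fun_prop
  · have h1 := norm_sub_norm_le w m
    have h2 : ‖w - m‖ < 1 := by simpa [dist_eq_norm] using hw
    linarith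

theorem continuous_whittakerSeries (β x : ℂ) :
    Continuous fun p : ℂ × ℂ => whittakerSeries β x p.1 p.2 := by
  rw [continuous_iff_continuousAt]
  intro p
  obtain ⟨u, hu, hb⟩ := exists_summable_bound_whittakerTerm β x (‖p‖ + 1)
  have : ContinuousOn (fun p : ℂ × ℂ => ∑' j, whittakerTerm β x p.1 p.2 j) (Metric.ball p 1) := by
    refine continuousOn_tsum (fun j => Continuous.continuousOn ?_) hu fun j q hq => ?_
    · refine Continuous.mul (Continuous.mul ?_
        ((differentiable_inv_Gamma_affine j).continuous.comp continuous_snd)) ?_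
      · fun_prop
      · fun_prop
    · have h1 := norm_sub_norm_le q p
      have h2 : ‖q - p‖ < 1 := by simpa [dist_eq_norm] using hq
      exact hb q.1 q.2 ((norm_fst_le q).trans (by linarith)) ((norm_snd_le q).trans (by linarith)) j
  exact this.continuousAt (Metric.ball_mem_nhds p one_pos)

theorem whittakerI_eq_whittakerSeries {β x t : ℂ} (ht : t ≠ 0) (m : ℂ) {w : ℂ}
    (hw : Complex.exp w = t * x) :
    whittakerI (β / t) m w =
      Complex.exp ((1 / 2 + m) * w) * Complex.exp (-(t * x) / 2) * whittakerSeries β x t m := by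
  rw [whittakerI, hw, whittakerSeries]
  congr 1
  refine tsum_congr fun j => ?_
  have hp : (ascPochhammer ℂ j).eval (1 / 2 + m - β / t) * t ^ j =
      ∏ i ∈ Finset.range j, (t * (1 / 2 + m + i) - β) := by
    induction j with
    | zero => simp
    | succ j ih =>
      rw [ascPochhammer_succ_eval, Finset.prod_range_succ, ← ih, pow_succ]
      field_simp
      ring
  rw [whittakerTerm, ← hp, mul_pow]
  ring

theorem besselI_eq_whittakerSeries {β x : ℂ} (m : ℂ) {w : ℂ}
    (hw : (Complex.exp w / 2) ^ 2 = -(β * x)) :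
    besselI (2 * m) w = Complex.exp ((2 * m + 1 / 2) * (w - Real.log 2)) * (√Real.pi : ℂ) *
      whittakerSeries β x 0 m := by
  rw [besselI, whittakerSeries, mul_assoc, ← tsum_mul_left (a := (√Real.pi : ℂ))]
  congr 1
  refine tsum_congr fun j => ?_
  rw [whittakerTerm, pow_mul, hw]
  simp only [zero_mul, zero_sub, Finset.prod_const, Finset.card_range]
  rw [show 2 * m + j + 1 = 1 + 2 * m + j by ring, neg_mul_eq_neg_mul, mul_pow]
  simp only [div_eq_mul_inv, mul_inv]
  ring

theorem besselJ_eq_whittakerSeries {β x : ℂ} (m : ℂ) {w : ℂ}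
    (hw : (Complex.exp w / 2) ^ 2 = β * x) :
    besselJ (2 * m) w = Complex.exp ((2 * m + 1 / 2) * (w - Real.log 2)) * (√Real.pi : ℂ) *
      whittakerSeries β x 0 m := by
  rw [besselJ, whittakerSeries, mul_assoc, ← tsum_mul_left (a := (√Real.pi : ℂ))]
  congr 1
  refine tsum_congr fun j => ?_
  rw [whittakerTerm, pow_mul, hw]
  simp only [zero_mul, zero_sub, Finset.prod_const, Finset.card_range]
  rw [show 2 * m + j + 1 = 1 + 2 * m + j by ring, mul_pow, neg_pow β]
  simp only [div_eq_mul_inv, mul_inv]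
  ring

/-- At m = −1/2 the coefficient 1/Γ(j) kills the term j = 0. Shifting the index recovers the series
at m = 1/2, the first factor of the product being −β. -/
theorem whittakerSeries_neg_half (β x t : ℂ) :
    whittakerSeries β x t (-(1 / 2)) = -(β * x) * whittakerSeries β x t (1 / 2) := by
  obtain ⟨u, hu, hb⟩ := exists_summable_bound_whittakerTerm β x (max ‖t‖ ‖(-(1 / 2) : ℂ)‖)
  have hs : Summable (whittakerTerm β x t (-(1 / 2))) :=
    Summable.of_norm_bounded hu (hb t _ (le_max_left _ _) (le_max_right _ _))
  rw [whittakerSeries, hs.tsum_eq_zero_add, whittakerSeries, ← tsum_mul_left]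
  have h0 : whittakerTerm β x t (-(1 / 2)) 0 = 0 := by
    simp [whittakerTerm]
  rw [h0, zero_add]
  refine tsum_congr fun j => ?_
  rw [whittakerTerm, whittakerTerm, Finset.prod_range_succ', Nat.factorial_succ,
    show (1 + 2 * -(1 / 2) + ↑(j + 1) : ℂ) = j + 1 by push_cast; ring,
    show (1 + 2 * (1 / 2) + j : ℂ) = (j + 1 : ℂ) + 1 by ring,
    Complex.Gamma_add_one (j + 1 : ℂ) (by exact_mod_cast j.succ_ne_zero)]
  have e : ∏ k ∈ Finset.range j, (t * (1 / 2 + -(1 / 2) + ↑(k + 1)) - β) =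
      ∏ i ∈ Finset.range j, (t * (1 / 2 + 1 / 2 + i) - β) :=
    Finset.prod_congr rfl fun k _ => by push_cast; ring
  rw [e]
  have hj : (j + 1 : ℂ) ≠ 0 := by exact_mod_cast j.succ_ne_zero
  push_cast
  field_simp
  ring

/-! ### Limits of I and J -/

theorem tendsto_re_of_exp_eq {ln : ℂ → ℂ} (hln : ∀ z : ℂ, z ≠ 0 → Complex.exp (ln z) = z) :
    Tendsto (fun k : ℂ => (ln k).re) (𝓝[≠] 0) atBot := by
  have h1 : Tendsto (fun k : ℂ => Real.log ‖k‖) (𝓝[≠] 0) atBot :=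
    Real.tendsto_log_nhdsNE_zero.comp (by
      refine tendsto_nhdsWithin_iff.2 ⟨?_, ?_⟩
      · exact (tendsto_norm_zero (E := ℂ)).mono_left nhdsWithin_le_nhds
      · filter_upwards [self_mem_nhdsWithin] with k hk
        simpa using hk)
  refine h1.congr' ?_
  filter_upwards [self_mem_nhdsWithin] with k hk
  have := hln k hk
  rw [← Real.log_exp (ln k).re, ← Complex.norm_exp, this]

theorem exp_mul_besselJ_eq {x : ℝ} (hx : 0 < x) {β lβ : ℂ} (hβ : Complex.exp lβ = β) (m : ℂ) :
    Complex.exp ((-m - 1 / 2) * lβ) *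
        (Complex.exp (1 / 4 * (lβ + Real.log x)) / (√Real.pi : ℂ)) *
        besselJ (2 * m) (Real.log 2 + (lβ + Real.log x) / 2) =
      Complex.exp ((1 / 2 + m) * Real.log x) * whittakerSeries β x 0 m := by
  have hex : Complex.exp (Real.log x : ℂ) = x := by rw [← Complex.ofReal_exp, Real.exp_log hx]
  have he2 : Complex.exp (Real.log 2 : ℂ) = 2 := by
    rw [← Complex.ofReal_exp, Real.exp_log two_pos]; simp
  have hw : (Complex.exp (Real.log 2 + (lβ + Real.log x) / 2) / 2) ^ 2 = β * x := by
    rw [Complex.exp_add, he2, mul_div_cancel_left₀ _ two_ne_zero, ← Complex.exp_nat_mul,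
      ← hβ, ← hex, ← Complex.exp_add]
    congr 1
    push_cast
    ring
  have hpi : (√Real.pi : ℂ) ≠ 0 := by
    exact_mod_cast (Real.sqrt_pos.2 Real.pi_pos).ne'
  rw [besselJ_eq_whittakerSeries m hw]
  have e : Complex.exp ((1 / 2 + m) * Real.log x) = Complex.exp ((-m - 1 / 2) * lβ) *
      Complex.exp (1 / 4 * (lβ + Real.log x)) *
      Complex.exp ((2 * m + 1 / 2) * (Real.log 2 + (lβ + Real.log x) / 2 - Real.log 2)) := by
    rw [← Complex.exp_add, ← Complex.exp_add]
    congr 1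
    ring
  rw [e]
  field_simp

theorem tendsto_exp_mul_whittakerSeries (β x m : ℂ) :
    Tendsto (fun t : ℂ => Complex.exp (-(t * x) / 2) * whittakerSeries β x t m) (𝓝 0)
      (𝓝 (whittakerSeries β x 0 m)) := by
  have h1 := (continuous_whittakerSeries β x).comp (by fun_prop : Continuous fun t : ℂ => (t, m))
  simp only [Function.comp_def] at h1
  have h2 : Continuous fun t : ℂ => Complex.exp (-(t * x) / 2) * whittakerSeries β x t m := by
    fun_prop
  have h3 := h2.tendsto 0
  rwa [zero_mul, neg_zero, zero_div, Complex.exp_zero, one_mul] at h3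

/-- The rotation θ covers I (θ = 0) and J (θ = iπ/2) at once: it only replaces t = 2k by 2k e^θ,
which still tends to 0. -/
theorem tendsto_whittakerI {ln : ℂ → ℂ} (hln : ∀ z : ℂ, z ≠ 0 → Complex.exp (ln z) = z) {x : ℝ}
    (hx : 0 < x) (m β θ : ℂ) :
    Tendsto (fun k : ℂ => Complex.exp ((1 / 2 + m) * (-(Real.log 2 + ln k))) *
        (Complex.exp (-(θ * (1 / 2 + m))) *
        whittakerI (β / (2 * k * Complex.exp θ)) m (Real.log 2 + ln k + Real.log x + θ))) (𝓝[≠] 0)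
      (𝓝 (Complex.exp ((1 / 2 + m) * Real.log x) * whittakerSeries β x 0 m)) := by
  have hex : Complex.exp (Real.log x : ℂ) = x := by rw [← Complex.ofReal_exp, Real.exp_log hx]
  have he2 : Complex.exp (Real.log 2 : ℂ) = 2 := by
    rw [← Complex.ofReal_exp, Real.exp_log two_pos]; simp
  have ht : Tendsto (fun k : ℂ => 2 * k * Complex.exp θ) (𝓝[≠] 0) (𝓝 0) := by
    have : Continuous fun k : ℂ => 2 * k * Complex.exp θ := by fun_prop
    simpa using (this.tendsto 0).mono_left nhdsWithin_le_nhds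
  refine (((tendsto_exp_mul_whittakerSeries β x m).comp ht).const_mul
    (Complex.exp ((1 / 2 + m) * Real.log x))).congr' ?_
  filter_upwards [self_mem_nhdsWithin] with k hk
  have hk0 : 2 * k * Complex.exp θ ≠ 0 :=
    mul_ne_zero (mul_ne_zero two_ne_zero hk) (Complex.exp_ne_zero θ)
  have hw : Complex.exp (Real.log 2 + ln k + Real.log x + θ) = 2 * k * Complex.exp θ * x := by
    rw [Complex.exp_add, Complex.exp_add, Complex.exp_add, he2, hln k hk, hex]
    ring
  rw [whittakerI_eq_whittakerSeries hk0 m hw]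
  have e : Complex.exp ((1 / 2 + m) * Real.log x) =
      Complex.exp ((1 / 2 + m) * (-(Real.log 2 + ln k))) * Complex.exp (-(θ * (1 / 2 + m))) *
      Complex.exp ((1 / 2 + m) * (Real.log 2 + ln k + Real.log x + θ)) := by
    rw [← Complex.exp_add, ← Complex.exp_add]
    congr 1
    ring
  rw [e]
  simp only [Function.comp_apply]
  ring

/-! ### Connection formulas for K and the Hankel functions -/

/-- The factor through which the Gamma functions enter the connection formula for `K_{exp L, m}`. -/
noncomputable def gammaFactor (L m : ℂ) : ℂ :=
  Complex.Gamma (1 / 2 + m - Complex.exp L) / Complex.Gamma (1 / 2 - m - Complex.exp L) *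
    Complex.exp (-2 * m * L)

/-- The entire numerator of the connection formulas for the Whittaker functions `K_{1/t,m}` and, at
`t = 0`, for the Macdonald functions. -/
noncomputable def macdonaldNumerator (Y t G m : ℂ) : ℂ :=
  Complex.exp (-(t * Complex.exp Y) / 2) *
    (Complex.exp ((1 / 2 - m) * Y) * whittakerSeries 1 (Complex.exp Y) t (-m) -
      G * Complex.exp ((1 / 2 + m) * Y) * whittakerSeries 1 (Complex.exp Y) t m)

theorem continuous_macdonaldNumerator (Y : ℂ) :
    Continuous fun p : ℂ × ℂ × ℂ => macdonaldNumerator Y p.1 p.2.1 p.2.2 := by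
  have h := continuous_whittakerSeries 1 (Complex.exp Y)
  have h1 := h.comp (by fun_prop : Continuous fun p : ℂ × ℂ × ℂ => (p.1, p.2.2))
  have h2 := h.comp (by fun_prop : Continuous fun p : ℂ × ℂ × ℂ => (p.1, -p.2.2))
  simp only [Function.comp_def] at h1 h2
  unfold macdonaldNumerator
  fun_prop

theorem DifferentiableAt.macdonaldNumerator (Y t : ℂ) {G : ℂ → ℂ} {m : ℂ}
    (hG : DifferentiableAt ℂ G m) :
    DifferentiableAt ℂ (fun m => macdonaldNumerator Y t (G m) m) m := by
  have h1 := (differentiable_whittakerSeries 1 (Complex.exp Y) t) m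
  have h2 : DifferentiableAt ℂ (fun m => whittakerSeries 1 (Complex.exp Y) t (-m)) m :=
    ((differentiable_whittakerSeries 1 (Complex.exp Y) t) (-m)).comp m (by fun_prop)
  unfold _root_.macdonaldNumerator
  fun_prop

/-- At m = 0 the two terms coincide; at m = ±1/2 they cancel by `whittakerSeries_neg_half`. The
required values of G hold for `gammaFactor` and for its limit alike. -/
theorem macdonaldNumerator_eq_zero (Y t : ℂ) {G m : ℂ}
    (h : m = 0 ∧ G = 1 ∨ (m = 1 / 2 ∨ m = -(1 / 2)) ∧ G = -1) :
    macdonaldNumerator Y t G m = 0 := by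
  rcases h with ⟨rfl, rfl⟩ | ⟨rfl | rfl, rfl⟩
  · simp [macdonaldNumerator]
  · rw [macdonaldNumerator, whittakerSeries_neg_half]
    have : (1 / 2 + 1 / 2 : ℂ) = 1 := by norm_num
    rw [this, sub_self, zero_mul, Complex.exp_zero, one_mul Y]
    ring
  · rw [macdonaldNumerator, neg_neg, whittakerSeries_neg_half]
    have : (1 / 2 - -(1 / 2) : ℂ) = 1 := by norm_num
    rw [this, add_neg_cancel, zero_mul, Complex.exp_zero, one_mul Y]
    ring

theorem Gamma_sub_exp_ne_zero {s L : ℂ} (h : s.im ≠ (Complex.exp L).im) :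
    ∀ n : ℕ, s - Complex.exp L ≠ -n := fun n hn => by
  have := congrArg Complex.im hn
  simp only [Complex.sub_im, Complex.neg_im, Complex.natCast_im, neg_zero] at this
  exact h (sub_eq_zero.1 this)

theorem differentiableAt_gammaFactor {L m : ℂ} (h : m.im ≠ (Complex.exp L).im) :
    DifferentiableAt ℂ (gammaFactor L) m := by
  have h1 : DifferentiableAt ℂ (fun m => Complex.Gamma (1 / 2 + m - Complex.exp L)) m :=
    (Complex.differentiableAt_Gamma _ (Gamma_sub_exp_ne_zero (by simpa using h))).comp m
      (by fun_prop)
  have h2 : DifferentiableAt ℂ (fun m => (Complex.Gamma (1 / 2 - m - Complex.exp L))⁻¹) m :=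
    (Complex.differentiable_one_div_Gamma _).comp m (by fun_prop)
  unfold gammaFactor
  simp only [div_eq_mul_inv] at h1 h2 ⊢
  fun_prop

theorem gammaFactor_zero {L : ℂ} (h : (Complex.exp L).im ≠ 0) : gammaFactor L 0 = 1 := by
  have := Complex.Gamma_ne_zero
    (Gamma_sub_exp_ne_zero (s := 1 / 2) (L := L) (by simpa using h.symm))
  rw [gammaFactor, add_zero, sub_zero, div_self this]
  simp

theorem gammaFactor_half {L : ℂ} (h : (Complex.exp L).im ≠ 0) : gammaFactor L (1 / 2) = -1 := by
  have := Complex.Gamma_ne_zero (Gamma_sub_exp_ne_zero (s := 0) (L := L) (by simpa using h.symm))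
  rw [zero_sub] at this
  have he := Complex.exp_ne_zero L
  rw [gammaFactor, show 1 / 2 + 1 / 2 - Complex.exp L = -Complex.exp L + 1 by ring,
    show 1 / 2 - 1 / 2 - Complex.exp L = -Complex.exp L by ring,
    Complex.Gamma_add_one _ (neg_ne_zero.2 he), show -2 * (1 / 2) * L = -L by ring, Complex.exp_neg]
  field_simp

theorem gammaFactor_neg_half {L : ℂ} (h : (Complex.exp L).im ≠ 0) :
    gammaFactor L (-(1 / 2)) = -1 := by
  have := Complex.Gamma_ne_zero (Gamma_sub_exp_ne_zero (s := 0) (L := L) (by simpa using h.symm))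
  rw [zero_sub] at this
  have he := Complex.exp_ne_zero L
  rw [gammaFactor, show 1 / 2 - -(1 / 2) - Complex.exp L = -Complex.exp L + 1 by ring,
    show 1 / 2 + -(1 / 2) - Complex.exp L = -Complex.exp L by ring,
    Complex.Gamma_add_one _ (neg_ne_zero.2 he), show -2 * -(1 / 2) * L = L by ring]
  field_simp

theorem mul_whittakerKGeneric_eq {L m : ℂ} (h : m.im ≠ (Complex.exp L).im) (Y : ℂ) :
    Complex.Gamma (1 / 2 + m - Complex.exp L) * Complex.exp ((1 / 2 - m) * L) *
        whittakerKGeneric (Complex.exp L) m (Y - L) =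
      Real.pi / Complex.sin (2 * Real.pi * m) *
        macdonaldNumerator Y (Complex.exp (-L)) (gammaFactor L m) m := by
  have hG := Complex.Gamma_ne_zero
    (Gamma_sub_exp_ne_zero (s := 1 / 2 + m) (L := L) (by simpa using h))
  have hL : Complex.exp L = 1 / Complex.exp (-L) := by rw [Complex.exp_neg, one_div, inv_inv]
  have hw : Complex.exp (Y - L) = Complex.exp (-L) * Complex.exp Y := by
    rw [← Complex.exp_add]; congr 1; ring
  have hI : ∀ m, whittakerI (Complex.exp L) m (Y - L) = Complex.exp ((1 / 2 + m) * (Y - L)) *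
      Complex.exp (-(Complex.exp (-L) * Complex.exp Y) / 2) *
        whittakerSeries 1 (Complex.exp Y) (Complex.exp (-L)) m := fun m => by
    rw [hL]; exact whittakerI_eq_whittakerSeries (Complex.exp_ne_zero _) m hw
  rw [whittakerKGeneric, hI, hI, macdonaldNumerator, gammaFactor]
  have e1 : Complex.exp ((1 / 2 - m) * L) * Complex.exp ((1 / 2 + m) * (Y - L)) =
      Complex.exp (-2 * m * L) * Complex.exp ((1 / 2 + m) * Y) := by
    rw [← Complex.exp_add, ← Complex.exp_add]; congr 1; ring
  have e2 : Complex.exp ((1 / 2 - m) * L) * Complex.exp ((1 / 2 + -m) * (Y - L)) =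
      Complex.exp ((1 / 2 - m) * Y) := by
    rw [← Complex.exp_add]; congr 1; ring
  generalize Complex.exp (-(Complex.exp (-L) * Complex.exp Y) / 2) = E
  generalize whittakerSeries 1 (Complex.exp Y) (Complex.exp (-L)) m = S
  generalize whittakerSeries 1 (Complex.exp Y) (Complex.exp (-L)) (-m) = S'
  generalize Complex.Gamma (1 / 2 + m - Complex.exp L) = Γ₁ at *
  calc _ = (Real.pi / Complex.sin (2 * Real.pi * m)) * (E *
        ((Complex.exp ((1 / 2 - m) * L) * Complex.exp ((1 / 2 + -m) * (Y - L))) * S' * (Γ₁ / Γ₁) -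
        Γ₁ / Complex.Gamma (1 / 2 - m - Complex.exp L) *
        (Complex.exp ((1 / 2 - m) * L) * Complex.exp ((1 / 2 + m) * (Y - L))) * S)) := by ring
    _ = _ := by rw [e1, e2, div_self hG]; ring

/-- Rotating the argument by −σπ/2 turns (z/2)² into −e^Y, hence the series at t = 0, and leaves the
two terms with relative phase e^{−2πiσm}. -/
theorem mul_besselKGeneric_eq {σ : ℝ} (hσ : σ = 1 ∨ σ = -1) (Y m : ℂ) :
    Complex.exp (1 / 4 * Y) * Complex.exp (-(σ * Complex.I * (Real.pi / 2) * (2 * m + 1 / 2))) *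
        besselKGeneric (2 * m) (Real.log 2 + Y / 2 - σ * Complex.I * (Real.pi / 2)) =
      -(σ * Complex.I) * (√Real.pi : ℂ) / Complex.sin (2 * Real.pi * m) *
        macdonaldNumerator Y 0 (Complex.exp (-(σ * Complex.I * (2 * Real.pi * m)))) m := by
  have he2 : Complex.exp (Real.log 2 : ℂ) = 2 := by
    rw [← Complex.ofReal_exp, Real.exp_log two_pos]; simp
  have hI : Complex.exp (-(σ * Complex.I * (Real.pi / 2))) = -(σ * Complex.I) := by
    rcases hσ with rfl | rfl
    · rw [show -(((1 : ℝ) : ℂ) * Complex.I * (Real.pi / 2)) = -(Real.pi / 2 * Complex.I) by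
        push_cast; ring, Complex.exp_neg, Complex.exp_pi_div_two_mul_I]
      simp
    · rw [show -(((-1 : ℝ) : ℂ) * Complex.I * (Real.pi / 2)) = Real.pi / 2 * Complex.I by
        push_cast; ring, Complex.exp_pi_div_two_mul_I]
      simp
  have hsq : (-((σ : ℂ) * Complex.I)) ^ 2 = -1 := by
    rcases hσ with rfl | rfl <;> simp
  have hw : (Complex.exp (Real.log 2 + Y / 2 - σ * Complex.I * (Real.pi / 2)) / 2) ^ 2 =
      -(1 * Complex.exp Y) := by
    rw [sub_eq_add_neg, Complex.exp_add, Complex.exp_add, he2, hI, div_pow, mul_pow, hsq, mul_pow,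
      ← Complex.exp_nat_mul]
    push_cast
    rw [mul_div_cancel₀ Y two_ne_zero]
    ring
  rw [besselKGeneric, show -(2 * m) = 2 * -m by ring, besselI_eq_whittakerSeries m hw,
    besselI_eq_whittakerSeries (-m) hw, macdonaldNumerator,
    show (Real.pi * (2 * m) : ℂ) = 2 * Real.pi * m by ring, ← hI]
  have e1 : Complex.exp (1 / 4 * Y) *
      Complex.exp (-(σ * Complex.I * (Real.pi / 2) * (2 * m + 1 / 2))) *
      Complex.exp ((2 * m + 1 / 2) *
        (Real.log 2 + Y / 2 - σ * Complex.I * (Real.pi / 2) - Real.log 2)) =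
      Complex.exp (-(σ * Complex.I * (Real.pi / 2))) *
        (Complex.exp (-(σ * Complex.I * (2 * Real.pi * m))) * Complex.exp ((1 / 2 + m) * Y)) := by
    simp only [← Complex.exp_add]; congr 1; ring
  have e2 : Complex.exp (1 / 4 * Y) *
      Complex.exp (-(σ * Complex.I * (Real.pi / 2) * (2 * m + 1 / 2))) *
      Complex.exp ((2 * -m + 1 / 2) *
        (Real.log 2 + Y / 2 - σ * Complex.I * (Real.pi / 2) - Real.log 2)) =
      Complex.exp (-(σ * Complex.I * (Real.pi / 2))) * Complex.exp ((1 / 2 - m) * Y) := by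
    simp only [← Complex.exp_add]; congr 1; ring
  rw [zero_mul, neg_zero, zero_div, Complex.exp_zero, one_mul]
  linear_combination (√Real.pi : ℂ) / Complex.sin (2 * Real.pi * m) *
    (whittakerSeries 1 (Complex.exp Y) 0 (-m) * e2 - whittakerSeries 1 (Complex.exp Y) 0 m * e1)

/-! ### Values at half-integer m -/

/-- L'Hôpital's rule: f / sin is a quotient of difference quotients. This also proves that the limit
exists, without which `limUnder` carries no information. -/
theorem mul_limUnder_eq_of_sin_eq_zero {g p f : ℂ → ℂ} {A m₀ : ℂ}
    (h : ∀ᶠ m in 𝓝[≠] m₀, p m * g m = A / Complex.sin (2 * Real.pi * m) * f m)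
    (hp : ContinuousAt p m₀) (hp0 : p m₀ ≠ 0) (hf : DifferentiableAt ℂ f m₀) (hf0 : f m₀ = 0)
    (hs : Complex.sin (2 * Real.pi * m₀) = 0) :
    p m₀ * limUnder (𝓝[≠] m₀) g =
      A / (2 * Real.pi * Complex.cos (2 * Real.pi * m₀)) * deriv f m₀ := by
  have hcos : 2 * Real.pi * Complex.cos (2 * Real.pi * m₀) ≠ 0 := by
    have := Complex.sin_sq_add_cos_sq (2 * Real.pi * m₀)
    have h2 : Complex.cos (2 * Real.pi * m₀) ≠ 0 := fun h0 => by simp [hs, h0] at this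
    exact mul_ne_zero (mul_ne_zero two_ne_zero (by exact_mod_cast Real.pi_ne_zero)) h2
  have hsin : HasDerivAt (fun m : ℂ => Complex.sin (2 * Real.pi * m))
      (2 * Real.pi * Complex.cos (2 * Real.pi * m₀)) m₀ := by
    have := ((hasDerivAt_id m₀).const_mul (2 * Real.pi : ℂ)).csin
    simpa [mul_comm] using this
  have h1 := (hasDerivAt_iff_tendsto_slope.1 hf.hasDerivAt).div
    (hasDerivAt_iff_tendsto_slope.1 hsin) hcos
  have hp' : Tendsto p (𝓝[≠] m₀) (𝓝 (p m₀)) := hp.tendsto.mono_left nhdsWithin_le_nhds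
  have h2 := (h1.const_mul A).div hp' hp0
  have h3 : Tendsto g (𝓝[≠] m₀)
      (𝓝 (A * (deriv f m₀ / (2 * Real.pi * Complex.cos (2 * Real.pi * m₀))) / p m₀)) := by
    refine h2.congr' ?_
    filter_upwards [h, self_mem_nhdsWithin, hp'.eventually_ne hp0] with m hm hne hpm
    have hsub : m - m₀ ≠ 0 := sub_ne_zero.2 hne
    rw [Pi.div_apply, div_eq_iff hpm, mul_comm (g m), hm]
    simp only [Pi.div_apply, slope_def_field, hf0, hs, sub_zero]
    rw [div_div_div_cancel_right₀ hsub]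
    ring
  rw [h3.limUnder_eq]
  field_simp

theorem besselH_eq_of_half_integer {σ : ℝ} (hσ : σ = 1 ∨ σ = -1) (Y : ℂ) {m : ℂ}
    (hm : ∃ n : ℤ, 2 * m = n) (h0 : macdonaldNumerator Y 0
      (Complex.exp (-(σ * Complex.I * (2 * Real.pi * m)))) m = 0) :
    Complex.exp (1 / 4 * Y) * besselH σ (2 * m) (Real.log 2 + Y / 2) =
      -(σ * Complex.I) * (√Real.pi : ℂ) / (2 * Real.pi * Complex.cos (2 * Real.pi * m)) *
        deriv (fun m => macdonaldNumerator Y 0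
          (Complex.exp (-(σ * Complex.I * (2 * Real.pi * m)))) m) m := by
  have hs : Complex.sin (2 * Real.pi * m) = 0 := by
    obtain ⟨n, hn⟩ := hm
    rw [show 2 * Real.pi * m = (n : ℂ) * Real.pi by rw [← hn]; ring, Complex.sin_int_mul_pi]
  -- The Macdonald function is extended by continuity in its own order 2m; doubling carries
  -- punctured neighbourhoods of m to those of 2m.
  have hlim : ∀ g : ℂ → ℂ, limUnder (𝓝[≠] (2 * m)) g =
      limUnder (𝓝[≠] m) (fun m' => g (2 * m')) := fun g => by
    have := (Homeomorph.mulLeft₀ (2 : ℂ) two_ne_zero).map_punctured_nhds_eq m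
    rw [Homeomorph.coe_mulLeft₀] at this
    rw [limUnder, ← this, map_map, limUnder, Function.comp_def]
  rw [besselH, besselK, if_pos hm, hlim, ← mul_assoc]
  refine mul_limUnder_eq_of_sin_eq_zero (p := fun m => Complex.exp (1 / 4 * Y) *
      Complex.exp (-(σ * Complex.I * (Real.pi / 2) * (2 * m + 1 / 2))))
    (Eventually.of_forall fun m' => mul_besselKGeneric_eq hσ Y m') ?_ ?_ ?_ h0 hs
  · fun_prop
  · exact mul_ne_zero (Complex.exp_ne_zero _) (Complex.exp_ne_zero _)
  · exact DifferentiableAt.macdonaldNumerator Y 0 (by fun_prop)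

theorem besselH_eq_of_not_half_integer {σ : ℝ} (hσ : σ = 1 ∨ σ = -1) (Y : ℂ) {m : ℂ}
    (hm : ¬∃ n : ℤ, 2 * m = n) :
    Complex.exp (1 / 4 * Y) * besselH σ (2 * m) (Real.log 2 + Y / 2) =
      -(σ * Complex.I) * (√Real.pi : ℂ) / Complex.sin (2 * Real.pi * m) *
        macdonaldNumerator Y 0 (Complex.exp (-(σ * Complex.I * (2 * Real.pi * m)))) m := by
  rw [besselH, besselK, if_neg hm, ← mul_assoc, mul_besselKGeneric_eq hσ]

theorem mul_whittakerK_eq_of_half_integer {L m : ℂ} (hm : ∃ n : ℤ, 2 * m = n)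
    (h : m.im ≠ (Complex.exp L).im) (Y : ℂ)
    (h0 : macdonaldNumerator Y (Complex.exp (-L)) (gammaFactor L m) m = 0) :
    Complex.Gamma (1 / 2 + m - Complex.exp L) * Complex.exp ((1 / 2 - m) * L) *
        whittakerK (Complex.exp L) m (Y - L) =
      Real.pi / (2 * Real.pi * Complex.cos (2 * Real.pi * m)) *
        deriv (fun m => macdonaldNumerator Y (Complex.exp (-L)) (gammaFactor L m) m) m := by
  have hs : Complex.sin (2 * Real.pi * m) = 0 := by
    obtain ⟨n, hn⟩ := hm
    rw [show 2 * Real.pi * m = (n : ℂ) * Real.pi by rw [← hn]; ring, Complex.sin_int_mul_pi]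
  have hGd : DifferentiableAt ℂ (fun m => Complex.Gamma (1 / 2 + m - Complex.exp L)) m :=
    (Complex.differentiableAt_Gamma _ (Gamma_sub_exp_ne_zero (by simpa using h))).comp m
      (by fun_prop)
  rw [whittakerK, if_pos hm]
  refine mul_limUnder_eq_of_sin_eq_zero (p := fun m => Complex.Gamma (1 / 2 + m - Complex.exp L) *
    Complex.exp ((1 / 2 - m) * L)) ?_ ?_ ?_ ?_ h0 hs
  · have : ∀ᶠ m' in 𝓝[≠] m, m'.im ≠ (Complex.exp L).im :=
      ((Complex.continuous_im.tendsto m).mono_left nhdsWithin_le_nhds).eventually_ne h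
    filter_upwards [this] with m' hm'
    exact mul_whittakerKGeneric_eq hm' Y
  · exact hGd.continuousAt.mul (by fun_prop)
  · exact mul_ne_zero (Complex.Gamma_ne_zero (Gamma_sub_exp_ne_zero (by simpa using h)))
      (Complex.exp_ne_zero _)
  · exact DifferentiableAt.macdonaldNumerator Y _ (differentiableAt_gammaFactor h)

theorem half_integer_cases {m : ℂ} (hm : ∃ n : ℤ, 2 * m = n) (hre : -1 < m.re ∧ m.re < 1) :
    m = 0 ∨ m = 1 / 2 ∨ m = -(1 / 2) := by
  obtain ⟨n, hn⟩ := hm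
  have h1 : 2 * m.re = n := by simpa using congrArg Complex.re hn
  have h2 : -2 < n := by exact_mod_cast (by linarith [hre.1] : (-2 : ℝ) < n)
  have h3 : n < 2 := by exact_mod_cast (by linarith [hre.2] : (n : ℝ) < 2)
  have h4 : m = n / 2 := by rw [← hn]; ring
  have h5 : n = -1 ∨ n = 0 ∨ n = 1 := by omega
  rcases h5 with rfl | rfl | rfl
  · right; right; rw [h4]; push_cast; ring
  · left; rw [h4]; simp
  · right; left; rw [h4]; simp

theorem exp_neg_two_pi_mul_half {σ : ℝ} (hσ : σ = 1 ∨ σ = -1) {m : ℂ}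
    (hm : m = 1 / 2 ∨ m = -(1 / 2)) :
    Complex.exp (-(σ * Complex.I * (2 * Real.pi * m))) = -1 := by
  have h : -(σ * Complex.I * (2 * Real.pi * m)) = Real.pi * Complex.I ∨
      -(σ * Complex.I * (2 * Real.pi * m)) = -(Real.pi * Complex.I) := by
    rcases hσ with rfl | rfl <;> rcases hm with rfl | rfl
    · right; push_cast; ring
    · left; push_cast; ring
    · left; push_cast; ring
    · right; push_cast; ring
  rcases h with h | h
  · rw [h, Complex.exp_pi_mul_I]
  · rw [h, Complex.exp_neg, Complex.exp_pi_mul_I]; norm_num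

/-! ### Limits of K and the Hankel functions -/

/-- Convergence along l × 𝓝 m' at each point, with F continuous, is locally uniform convergence;
Weierstrass' theorem then passes to derivatives. -/
theorem tendsto_deriv_of_tendsto_prod {ι : Type*} {l : Filter ι} {f : ι → ℂ → ℂ} {F : ℂ → ℂ}
    {m : ℂ} (hf : ∀ m', Tendsto (fun p : ι × ℂ => f p.1 p.2) (l ×ˢ 𝓝 m') (𝓝 (F m')))
    (hF : Continuous F)
    (hd : ∀ᶠ i in l, DifferentiableOn ℂ (f i) (Metric.ball m 1)) :
    Tendsto (fun i => deriv (f i) m) l (𝓝 (deriv F m)) := by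
  have hu : TendstoLocallyUniformlyOn f F l (Metric.ball m 1) := by
    rw [Metric.isOpen_ball.tendstoLocallyUniformlyOn_iff_forall_tendsto]
    intro m' _
    have h1 : Tendsto (fun y : ι × ℂ => (F y.2, f y.1 y.2)) (l ×ˢ 𝓝 m') (𝓝 (F m', F m')) :=
      ((hF.tendsto m').comp tendsto_snd).prodMk_nhds (hf m')
    exact h1.mono_right (nhds_le_uniformity (F m'))
  exact (hu.deriv hd Metric.isOpen_ball).tendsto_at (Metric.mem_ball_self one_pos)

theorem tendsto_abs_im_exp {ι : Type*} {l : Filter ι} {σ : ℝ} (hσ : σ = 1 ∨ σ = -1) {ε : ℝ}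
    (hε : 0 < ε) {L : ι → ℂ} (hL : ∀ᶠ i in l, σ * (L i).im ∈ Set.Ioo ε (Real.pi - ε))
    (hre : Tendsto (fun i => (L i).re) l atTop) :
    Tendsto (fun i => |(Complex.exp (L i)).im|) l atTop := by
  rcases l.eq_or_neBot with rfl | _
  · simp
  have hs : 0 < Real.sin ε := by
    obtain ⟨i, hi⟩ := hL.exists
    exact Real.sin_pos_of_pos_of_lt_pi hε (by linarith [hi.1.trans hi.2])
  refine tendsto_atTop_mono' l ?_ ((Real.tendsto_exp_atTop.comp hre).atTop_mul_const hs)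
  filter_upwards [hL] with i hi
  rw [Complex.exp_im, abs_mul, Real.abs_exp]
  exact mul_le_mul_of_nonneg_left (sign_sin_le_abs_sin hσ hε hi) (Real.exp_pos _).le

theorem tendsto_macdonaldNumerator {ι : Type*} {l : Filter ι} {σ : ℝ} (hσ : σ = 1 ∨ σ = -1)
    {ε : ℝ} (hε : 0 < ε) {L : ι → ℂ} (hL : ∀ᶠ i in l, σ * (L i).im ∈ Set.Ioo ε (Real.pi - ε))
    (hre : Tendsto (fun i => (L i).re) l atTop) (Y m : ℂ) :
    Tendsto (fun p : ι × ℂ =>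
        macdonaldNumerator Y (Complex.exp (-L p.1)) (gammaFactor (L p.1) p.2) p.2) (l ×ˢ 𝓝 m)
      (𝓝 (macdonaldNumerator Y 0 (Complex.exp (-(σ * Complex.I * (2 * Real.pi * m)))) m)) := by
  have ht : Tendsto (fun i => Complex.exp (-L i)) l (𝓝 0) := by
    rw [tendsto_zero_iff_norm_tendsto_zero]
    simp only [Complex.norm_exp, Complex.neg_re]
    exact Real.tendsto_exp_neg_atTop_nhds_zero.comp hre
  have ht' : Tendsto (fun p : ι × ℂ => Complex.exp (-L p.1)) (l ×ˢ 𝓝 m) (𝓝 0) :=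
    ht.comp tendsto_fst
  have hG : Tendsto (fun p : ι × ℂ => gammaFactor (L p.1) p.2) (l ×ˢ 𝓝 m)
      (𝓝 (Complex.exp (-(σ * Complex.I * (2 * Real.pi * m))))) := by
    simp only [gammaFactor]
    exact tendsto_Gamma_ratio hσ hε hL hre m
  have hm : Tendsto (fun p : ι × ℂ => p.2) (l ×ˢ 𝓝 m) (𝓝 m) := tendsto_snd
  have h := ((continuous_macdonaldNumerator Y).tendsto
    (0, Complex.exp (-(σ * Complex.I * (2 * Real.pi * m))), m)).comp
      (ht'.prodMk_nhds (hG.prodMk_nhds hm))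
  simp only [Function.comp_def] at h
  exact h

theorem tendsto_whittakerK {ι : Type*} {l : Filter ι} {σ : ℝ} (hσ : σ = 1 ∨ σ = -1) {ε : ℝ}
    (hε : 0 < ε) {L : ι → ℂ} (hL : ∀ᶠ i in l, σ * (L i).im ∈ Set.Ioo ε (Real.pi - ε))
    (hre : Tendsto (fun i => (L i).re) l atTop) (Y : ℂ) {m : ℂ} (hm : -1 < m.re ∧ m.re < 1) :
    Tendsto (fun i => -(σ * Complex.I) *
        (Complex.Gamma (1 / 2 + m - Complex.exp (L i)) / (√Real.pi : ℂ)) *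
        Complex.exp ((1 / 2 - m) * L i) * whittakerK (Complex.exp (L i)) m (Y - L i)) l
      (𝓝 (Complex.exp (1 / 4 * Y) * besselH σ (2 * m) (Real.log 2 + Y / 2))) := by
  set f : ι → ℂ → ℂ := fun i m =>
    macdonaldNumerator Y (Complex.exp (-L i)) (gammaFactor (L i) m) m with hf
  set F : ℂ → ℂ := fun m =>
    macdonaldNumerator Y 0 (Complex.exp (-(σ * Complex.I * (2 * Real.pi * m)))) m with hF
  have hpi : (√Real.pi : ℂ) ≠ 0 := by
    exact_mod_cast (Real.sqrt_pos.2 Real.pi_pos).ne'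
  have hpi2 : (√Real.pi : ℂ) ^ 2 = Real.pi := by
    exact_mod_cast Real.sq_sqrt Real.pi_pos.le
  have hlim := tendsto_macdonaldNumerator hσ hε hL hre Y
  -- The poles of Γ(1/2 + m' − e^L) in m' lie on the line Im m' = Im e^L, which eventually leaves
  -- the unit disc about m.
  have him : ∀ᶠ i in l, ∀ m' : ℂ, ‖m' - m‖ < 1 → m'.im ≠ (Complex.exp (L i)).im := by
    filter_upwards [(tendsto_abs_im_exp hσ hε hL hre).eventually_ge_atTop (‖m‖ + 1)]
      with i hi m' hm' h
    rw [← h] at hi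
    have h1 := norm_sub_norm_le m' m
    have h2 := Complex.abs_im_le_norm m'
    linarith
  by_cases hmZ : ∃ n : ℤ, 2 * m = n
  · have hcases := half_integer_cases hmZ hm
    have hmim : m.im = 0 := by rcases hcases with rfl | rfl | rfl <;> simp
    have hF0 : F m = 0 := by
      refine macdonaldNumerator_eq_zero Y 0 ?_
      rcases hcases with rfl | h
      · left; simp
      · exact Or.inr ⟨h, exp_neg_two_pi_mul_half hσ h⟩
    have hFc : Continuous F := continuous_iff_continuousAt.2 fun m' =>
      (DifferentiableAt.macdonaldNumerator Y 0 (by fun_prop)).continuousAt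
    have hd : ∀ᶠ i in l, DifferentiableOn ℂ (f i) (Metric.ball m 1) := by
      filter_upwards [him] with i hi m' hm'
      refine (DifferentiableAt.macdonaldNumerator Y _
        (differentiableAt_gammaFactor (hi m' ?_))).differentiableWithinAt
      simpa [dist_eq_norm] using hm'
    have hder := tendsto_deriv_of_tendsto_prod hlim hFc hd
    rw [besselH_eq_of_half_integer hσ Y hmZ hF0]
    refine (hder.const_mul _).congr' ?_
    filter_upwards [him] with i hi
    have hi := hi m (by simp)
    have hne : (Complex.exp (L i)).im ≠ 0 := fun h => hi (hmim.trans h.symm)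
    have hf0 : f i m = 0 := by
      refine macdonaldNumerator_eq_zero Y _ ?_
      rcases hcases with rfl | rfl | rfl
      · exact Or.inl ⟨rfl, gammaFactor_zero hne⟩
      · exact Or.inr ⟨Or.inl rfl, gammaFactor_half hne⟩
      · exact Or.inr ⟨Or.inr rfl, gammaFactor_neg_half hne⟩
    have hK := mul_whittakerK_eq_of_half_integer hmZ hi Y hf0
    rw [← hpi2] at hK
    calc _ = -(σ * Complex.I) / (√Real.pi : ℂ) * ((√Real.pi : ℂ) ^ 2 /
          (2 * Real.pi * Complex.cos (2 * Real.pi * m)) * deriv (f i) m) := by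
          field_simp
      _ = _ := by rw [hpi2] at hK ⊢; rw [← hK]; ring
  · rw [besselH_eq_of_not_half_integer hσ Y hmZ]
    have hi : Tendsto (fun i => (i, m)) l (l ×ˢ 𝓝 m) := tendsto_id.prodMk tendsto_const_nhds
    have h1 := (hlim m).comp hi
    simp only [Function.comp_def] at h1
    refine (h1.const_mul _).congr' ?_
    filter_upwards [him] with i hi
    have hK := mul_whittakerKGeneric_eq (hi m (by simp)) Y
    rw [whittakerK, if_neg hmZ]
    calc _ = -(σ * Complex.I) / (√Real.pi : ℂ) * ((√Real.pi : ℂ) ^ 2 /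
          Complex.sin (2 * Real.pi * m) *
            macdonaldNumerator Y (Complex.exp (-L i)) (gammaFactor (L i) m) m) := by
          field_simp
      _ = _ := by rw [hpi2, ← hK]; ring

theorem propositionB1 (ln : ℂ → ℂ) (hln : IsPrincipalLn ln) (x : ℝ) (hx : 0 < x)
    (m : ℂ) (hm : -1 < m.re ∧ m.re < 1) (β : ℂ) (hβ : β ≠ 0) :
    -- `(1/2k)^(1/2+m) I_{β/2k,m}(2kx)` and `(1/2k)^(1/2+m) J_{β/2k,m}(2kx)` as `k → 0`
    Tendsto (fun k : ℂ => Complex.exp ((1 / 2 + m) * (-(Real.log 2 + ln k))) *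
          whittakerI (β / (2 * k)) m (Real.log 2 + ln k + Real.log x))
        (𝓝[≠] 0)
        (𝓝 (Complex.exp ((-m - 1 / 2) * ln β) *
          (Complex.exp (1 / 4 * (ln β + Real.log x)) / (√Real.pi : ℂ)) *
          besselJ (2 * m) (Real.log 2 + (ln β + Real.log x) / 2))) ∧
    Tendsto (fun k : ℂ => Complex.exp ((1 / 2 + m) * (-(Real.log 2 + ln k))) *
          whittakerJ (β / (2 * k)) m (Real.log 2 + ln k + Real.log x))
        (𝓝[≠] 0)
        (𝓝 (Complex.exp ((-m - 1 / 2) * ln β) *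
          (Complex.exp (1 / 4 * (ln β + Real.log x)) / (√Real.pi : ℂ)) *
          besselJ (2 * m) (Real.log 2 + (ln β + Real.log x) / 2))) ∧
    -- `∓i Γ(1/2+m-β/2k)/√π (β/2k)^(1/2-m) K_{β/2k,m}(2kx)` as `k → 0` in a sector
    (∀ σ : ℝ, σ = 1 ∨ σ = -1 → ∀ ε : ℝ, 0 < ε →
      Tendsto (fun k : ℂ => -(σ * Complex.I) *
            (Complex.Gamma (1 / 2 + m - β / (2 * k)) / (√Real.pi : ℂ)) *
            Complex.exp ((1 / 2 - m) * (ln β - (Real.log 2 + ln k))) *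
            whittakerK (β / (2 * k)) m (Real.log 2 + ln k + Real.log x))
          (𝓝[{k : ℂ | k ≠ 0 ∧ σ * ((ln β).im - (ln k).im) ∈ Set.Ioo ε (Real.pi - ε)}] 0)
          (𝓝 (Complex.exp (1 / 4 * (ln β + Real.log x)) *
            besselH σ (2 * m) (Real.log 2 + (ln β + Real.log x) / 2)))) ∧
    -- `Γ(1/2+m∓iβ/2μ)/√π (β/2μ)^(1/2-m) H^±_{β/2μ,m}(2μx)` as `μ → 0`, `μ > 0`
    (0 < β.re → ∀ σ : ℝ, σ = 1 ∨ σ = -1 →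
      Tendsto (fun μ : ℝ =>
            Complex.Gamma (1 / 2 + m - σ * Complex.I * (β / (2 * μ))) / (√Real.pi : ℂ) *
            (β / (2 * μ)) ^ (1 / 2 - m) *
            whittakerH σ (β / (2 * μ)) m (Real.log (2 * μ * x)))
          (𝓝[>] 0)
          (𝓝 (Complex.exp (1 / 4 * (ln β + Real.log x)) *
            besselH σ (2 * m) (Real.log 2 + (ln β + Real.log x) / 2)))) := by
  have hexp : ∀ z : ℂ, z ≠ 0 → Complex.exp (ln z) = z := fun z hz => (hln z hz).1
  have he2 : Complex.exp (Real.log 2 : ℂ) = 2 := by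
    rw [← Complex.ofReal_exp, Real.exp_log two_pos]; simp
  refine ⟨?_, ?_, fun σ hσ ε hε => ?_, fun hre σ hσ => ?_⟩
  · rw [exp_mul_besselJ_eq hx (hexp β hβ)]
    simpa using tendsto_whittakerI hexp hx m β 0
  · rw [exp_mul_besselJ_eq hx (hexp β hβ)]
    refine (tendsto_whittakerI hexp hx m β (Complex.I * (Real.pi / 2))).congr fun k => ?_
    have hI : Complex.exp (Complex.I * (Real.pi / 2)) = Complex.I := by
      rw [mul_comm, Complex.exp_pi_div_two_mul_I]
    have e : β / (2 * k * Complex.I) = -(Complex.I * (β / (2 * k))) := by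
      rw [← div_div, Complex.div_I]; ring
    rw [whittakerJ, hI, e]
  · have hre : Tendsto (fun k : ℂ => (ln β - (Real.log 2 + ln k)).re)
        (𝓝[{k : ℂ | k ≠ 0 ∧ σ * ((ln β).im - (ln k).im) ∈ Set.Ioo ε (Real.pi - ε)}] 0) atTop := by
      have h1 : Tendsto (fun k : ℂ => -(ln k).re)
          (𝓝[{k : ℂ | k ≠ 0 ∧ σ * ((ln β).im - (ln k).im) ∈ Set.Ioo ε (Real.pi - ε)}] 0) atTop :=
        tendsto_neg_atBot_atTop.comp ((tendsto_re_of_exp_eq hexp).mono_left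
          (nhdsWithin_mono _ fun k hk => hk.1))
      refine (tendsto_atTop_add_const_left _ ((ln β).re - Real.log 2) h1).congr fun k => ?_
      simp only [Complex.sub_re, Complex.add_re, Complex.ofReal_re]
      ring
    refine (tendsto_whittakerK hσ hε ?_ hre (ln β + Real.log x) hm).congr' ?_
    · filter_upwards [self_mem_nhdsWithin] with k hk
      have h2 := hk.2
      have e : (ln β - (Real.log 2 + ln k)).im = (ln β).im - (ln k).im := by
        simp only [Complex.sub_im, Complex.add_im, Complex.ofReal_im, zero_add]
      rwa [e]
    · filter_upwards [self_mem_nhdsWithin] with k hk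
      have e : Complex.exp (ln β - (Real.log 2 + ln k)) = β / (2 * k) := by
        rw [Complex.exp_sub, Complex.exp_add, he2, hexp β hβ, hexp k hk.1]
      rw [e, show ln β + Real.log x - (ln β - (Real.log 2 + ln k)) =
        Real.log 2 + ln k + Real.log x by ring]
  · have hlog : ln β = Complex.log β := hln.eq_log (Or.inl hre)
    have harg : |β.arg| < Real.pi / 2 := Complex.abs_arg_lt_pi_div_two_iff.2 (Or.inl hre)
    have hI : Complex.exp (σ * Complex.I * (Real.pi / 2)) = σ * Complex.I := by
      rcases hσ with rfl | rfl
      · rw [show ((1 : ℝ) : ℂ) * Complex.I * (Real.pi / 2) = Real.pi / 2 * Complex.I by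
          push_cast; ring, Complex.exp_pi_div_two_mul_I]
        simp
      · rw [show ((-1 : ℝ) : ℂ) * Complex.I * (Real.pi / 2) = -(Real.pi / 2 * Complex.I) by
          push_cast; ring, Complex.exp_neg, Complex.exp_pi_div_two_mul_I]
        simp
    have hI2 : -(σ * Complex.I) = Complex.exp (-(σ * Complex.I * (Real.pi / 2))) := by
      rw [Complex.exp_neg, hI]
      rcases hσ with rfl | rfl <;> simp
    -- The quarter turn makes e^L = σiβ/(2μ), the first index of K inside H^±.
    set L : ℝ → ℂ := fun μ => ln β - Real.log (2 * μ) + σ * Complex.I * (Real.pi / 2) with hLdef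
    have hLre : Tendsto (fun μ : ℝ => (L μ).re) (𝓝[>] 0) atTop := by
      have h1 : Tendsto (fun μ : ℝ => 2 * μ) (𝓝[>] 0) (𝓝[>] 0) := by
        refine tendsto_nhdsWithin_iff.2 ⟨?_, ?_⟩
        · have : Continuous fun μ : ℝ => 2 * μ := by fun_prop
          simpa using (this.tendsto 0).mono_left nhdsWithin_le_nhds
        · filter_upwards [self_mem_nhdsWithin] with μ hμ
          exact mul_pos two_pos (Set.mem_Ioi.1 hμ)
      have h2 := tendsto_neg_atBot_atTop.comp (Real.tendsto_log_nhdsGT_zero.comp h1)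
      refine (tendsto_atTop_add_const_left _ (ln β).re h2).congr fun μ => ?_
      simp [hLdef, sub_eq_add_neg]
    have hLim : ∀ μ, σ * (L μ).im = σ * β.arg + Real.pi / 2 := fun μ => by
      have : (L μ).im = β.arg + σ * (Real.pi / 2) := by
        simp [hLdef, hlog, Complex.log_im]
      rw [this]
      rcases hσ with rfl | rfl <;> ring
    -- Since σ Im L = σ arg β + π/2, the condition Re β > 0 keeps it at distance at least π/2 − |arg
    -- β|, twice this margin, from 0 and π.
    have hε : 0 < (Real.pi / 2 - |β.arg|) / 2 := by linarith
    refine (tendsto_whittakerK hσ hε (Eventually.of_forall fun μ => ?_) hLre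
      (ln β + Real.log x) hm).congr' ?_
    · rw [hLim]
      have h1 := abs_le.1 (le_refl |β.arg|)
      rcases hσ with rfl | rfl <;> constructor <;> linarith
    · filter_upwards [self_mem_nhdsWithin] with μ hμ
      have hμ : 0 < μ := hμ
      have hμ2 : Complex.exp (Real.log (2 * μ) : ℂ) = 2 * μ := by
        rw [← Complex.ofReal_exp, Real.exp_log (by positivity)]; simp
      have eL : Complex.exp (L μ) = σ * Complex.I * (β / (2 * μ)) := by
        rw [hLdef, Complex.exp_add, Complex.exp_sub, hexp β hβ, hμ2, hI]; ring
      have eY : ln β + Real.log x - L μ =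
          Real.log (2 * μ * x) - σ * Complex.I * (Real.pi / 2) := by
        rw [hLdef, Real.log_mul (by positivity) hx.ne']; push_cast; ring
      have hpow : (β / (2 * μ)) ^ (1 / 2 - m) =
          Complex.exp ((1 / 2 - m) * (ln β - Real.log (2 * μ))) := by
        have h1 : β / (2 * μ) = ((2 * μ)⁻¹ : ℝ) * β := by push_cast; ring
        have h2 : β / (2 * μ) ≠ 0 :=
          div_ne_zero hβ (mul_ne_zero two_ne_zero (by exact_mod_cast hμ.ne'))
        rw [Complex.cpow_def_of_ne_zero h2, h1, Complex.log_ofReal_mul (by positivity) hβ,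
          Real.log_inv, hlog]
        congr 1
        push_cast
        ring
      rw [eL, eY, whittakerH, hpow, hI2]
      -- The prefactor ∓i and the quarter turn in L combine to the phase in the definition of H^±.
      have e : Complex.exp (-(σ * Complex.I * (Real.pi / 2))) * Complex.exp ((1 / 2 - m) * L μ) =
          Complex.exp ((1 / 2 - m) * (ln β - Real.log (2 * μ))) *
          Complex.exp (-(σ * Complex.I * (Real.pi / 2) * (1 / 2 + m))) := by
        rw [← Complex.exp_add, ← Complex.exp_add]
        congr 1
        simp only [hLdef]
        ring
      linear_combination (Complex.Gamma (1 / 2 + m - σ * Complex.I * (β / (2 * μ))) /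
        (√Real.pi : ℂ) * whittakerK (σ * Complex.I * (β / (2 * μ))) m
          (Real.log (2 * μ * x) - σ * Complex.I * (Real.pi / 2))) * e
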